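/- Let $d>0$ be a squarefree integer with $d\neq 1,3$, let $K=\mathbb{Q}(\sqrt{-d})$ with ring of integers $\mathcal{O}_K$, and let $p>2$ be a prime dividing $d$. Let $G$ be a cyclic group of order $p$, let $\Lambda=\mathcal{O}_K[G]$, and let $\mathrm{Cl}(\Lambda)$ be the locally free class group of $\Lambda$, i.e. the group of stable isomorphism classes of locally free $\Lambda$-modules under direct sum ($M$ and $N$ being stably isomorphic if $M\oplus\Lambda^m\cong N\oplus\Lambda^n$ for some $m,n\ge 0$). Put $\Sigma=\sum_{g\in G}g$, and for $r\in\mathcal{O}_K$ relatively prime to $p$ let $\langle r,\Sigma\rangle=r\Lambda+\Lambda\Sigma$ be the Swan module, a locally free $\Lambda$-module. Then the set $T(\Lambda)$ of classes of the Swan modules $\langle r,\Sigma\rangle$, for all $r\in\mathcal{O}_K$ relatively prime to $p$, is a subgroup of $\mathrm{Cl}(\Lambda)$ (the Swan subgroup), and $$T(\Lambda)\cong C_p,$$ where $C_p$ is the cyclic group of order $p$. -/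

import Mathlib

open TensorProduct

universe v

namespace SwanClass

/-- The image in the `O`-algebra `Λ` of the complement of the prime `q` of `O`; inverting it gives
`Λ_q = O_q ⊗[O] Λ`, and likewise `M_q` for a `Λ`-module `M`. -/
abbrev locMonoid {O : Type*} (Λ : Type*) [CommRing O] [CommRing Λ] [Algebra O Λ]
    (q : Ideal O) [q.IsPrime] : Submonoid Λ :=
  Algebra.algebraMapSubmonoid Λ q.primeCompl

/-- A locally free module over the `O`-order `Λ`: a finitely generated `Λ`-module `M` such that
`M_q` is a free `Λ_q`-module for every maximal ideal `q` of the base ring `O`. -/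
structure IsLocallyFree (O Λ M : Type*) [CommRing O] [CommRing Λ] [Algebra O Λ]
    [AddCommGroup M] [Module Λ M] : Prop where
  finite : Module.Finite Λ M
  free : ∀ (q : Ideal O) [q.IsMaximal],
    Module.Free (Localization (locMonoid Λ q)) (LocalizedModule (locMonoid Λ q) M)

section
variable {O Λ M N : Type*} [CommRing O] [CommRing Λ] [Algebra O Λ]
    [AddCommGroup M] [Module Λ M] [AddCommGroup N] [Module Λ N]

theorem free_iff_tensor (S : Submonoid Λ) :
    Module.Free (Localization S) (LocalizedModule S M) ↔
      Module.Free (Localization S) (Localization S ⊗[Λ] M) :=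
  Module.Free.iff_of_equiv (LocalizedModule.equivTensorProduct S M)

theorem IsLocallyFree.of_free [Module.Finite Λ M] [Module.Free Λ M] : IsLocallyFree O Λ M :=
  ⟨inferInstance, fun _ _ ↦ (free_iff_tensor _).2 inferInstance⟩

theorem IsLocallyFree.prod (hM : IsLocallyFree O Λ M) (hN : IsLocallyFree O Λ N) :
    IsLocallyFree O Λ (M × N) := by
  have := hM.finite
  have := hN.finite
  refine ⟨inferInstance, fun q _ ↦ (free_iff_tensor _).2 ?_⟩
  have h1 := (free_iff_tensor _).1 (hM.free q)
  have h2 := (free_iff_tensor _).1 (hN.free q)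
  exact Module.Free.of_equiv (TensorProduct.prodRight Λ (Localization (locMonoid Λ q))
    (Localization (locMonoid Λ q)) M N).symm

theorem finite_maximalSpectrum [Module.Finite O Λ] (q : Ideal O) [q.IsMaximal] :
    Finite (MaximalSpectrum (Localization (locMonoid Λ q))) := by
  have hfin : Module.Finite (Localization.AtPrime q) (Localization (locMonoid Λ q)) :=
    Module.Finite.of_isLocalizedModule q.primeCompl
      (IsScalarTower.toAlgHom O Λ (Localization (locMonoid Λ q))).toLinearMap
  have hf := Algebra.QuasiFinite.finite_primesOver (S := Localization (locMonoid Λ q))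
    (IsLocalRing.maximalIdeal (Localization.AtPrime q))
  have := hf.to_subtype
  refine Finite.of_injective (β := (IsLocalRing.maximalIdeal (Localization.AtPrime q)).primesOver
    (Localization (locMonoid Λ q))) (fun P ↦ ⟨P.asIdeal, P.isMaximal.isPrime, ⟨?_⟩⟩) ?_
  · have := P.isMaximal
    exact (IsLocalRing.eq_maximalIdeal
      (Ideal.isMaximal_comap_of_isIntegral_of_isMaximal P.asIdeal)).symm
  · intro P Q h
    exact MaximalSpectrum.ext (congrArg Subtype.val h)

theorem IsLocallyFree.projective [IsNoetherianRing O] [Module.Finite O Λ]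
    (hM : IsLocallyFree O Λ M) : Module.Projective Λ M := by
  have : IsNoetherianRing Λ := IsNoetherianRing.of_finite O Λ
  have := hM.finite
  have := Module.finitePresentation_of_finite Λ M
  refine Module.projective_of_localization_maximal fun P hP ↦ ?_
  have := Ideal.isMaximal_comap_of_isIntegral_of_isMaximal (R := O) P
  have hfree := hM.free (P.comap (algebraMap O Λ))
  set S := locMonoid Λ (P.comap (algebraMap O Λ))
  have hdisj : Disjoint (S : Set Λ) (P : Set Λ) := by
    rw [Set.disjoint_left]
    rintro _ ⟨x, hx, rfl⟩ h
    exact hx h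
  have hP' := IsLocalization.isPrime_of_isPrime_disjoint S (Localization S) P hP.isPrime hdisj
  have hc := IsLocalization.under_map_of_isPrime_disjoint S (Localization S) hP.isPrime hdisj
  have hu : Module.freeLocus (Localization S) (LocalizedModule S M) = Set.univ :=
    Module.freeLocus_eq_univ
  rw [Module.freeLocus_localization] at hu
  have : (PrimeSpectrum.comap (algebraMap Λ (Localization S)) ⟨_, hP'⟩) ∈
      Module.freeLocus Λ M := by
    have : (⟨_, hP'⟩ : PrimeSpectrum (Localization S)) ∈ _ := hu.symm ▸ Set.mem_univ _
    exact this
  have e : PrimeSpectrum.comap (algebraMap Λ (Localization S)) ⟨_, hP'⟩ = ⟨P, hP.isPrime⟩ :=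
    PrimeSpectrum.ext hc
  rw [e] at this
  have : Module.Free (Localization.AtPrime P) (LocalizedModule P.primeCompl M) := this
  infer_instance

theorem IsLocallyFree.of_prod_equiv [Module.Finite O Λ] {n : ℕ} (hM : IsLocallyFree O Λ M)
    [Module.Finite Λ N] [Module.Projective Λ N] (e : (M × N) ≃ₗ[Λ] (Fin n → Λ)) :
    IsLocallyFree O Λ N := by
  have := hM.finite
  refine ⟨inferInstance, fun q _ ↦ (free_iff_tensor _).2 ?_⟩
  have hfree := (free_iff_tensor _).1 (hM.free q)
  have := finite_maximalSpectrum (Λ := Λ) q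
  set A := Localization (locMonoid Λ q)
  let e' : ((A ⊗[Λ] M) × (A ⊗[Λ] N)) ≃ₗ[A] (Fin n → A) :=
    (TensorProduct.prodRight Λ A A M N).symm ≪≫ₗ
      TensorProduct.AlgebraTensorModule.congr (LinearEquiv.refl A A) e ≪≫ₗ
      TensorProduct.piScalarRight Λ A A (Fin n)
  refine Module.free_of_flat_of_finrank_eq A (A ⊗[Λ] N) (n - Module.finrank A (A ⊗[Λ] M)) ?_
  intro P
  let := Ideal.Quotient.field P.asIdeal
  have h := (((TensorProduct.prodRight A (A ⧸ P.asIdeal) (A ⧸ P.asIdeal)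
    (A ⊗[Λ] M) (A ⊗[Λ] N)).symm) ≪≫ₗ
      TensorProduct.AlgebraTensorModule.congr (LinearEquiv.refl (A ⧸ P.asIdeal) _) e' ≪≫ₗ
      TensorProduct.piScalarRight A _ (A ⧸ P.asIdeal) (Fin n)).finrank_eq
  have : Nontrivial A := by
    by_contra hA
    have := not_nontrivial_iff_subsingleton.1 hA
    exact P.isMaximal.ne_top (Subsingleton.elim _ _)
  rw [Module.finrank_prod, Module.finrank_baseChange, Module.finrank_fin_fun] at h
  omega

theorem IsLocallyFree.exists_compl [IsNoetherianRing O] [Module.Finite O Λ]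
    (hM : IsLocallyFree O Λ M) : ∃ (n : ℕ) (N : Submodule Λ (Fin n → Λ)),
      IsLocallyFree O Λ N ∧ Nonempty ((M × N) ≃ₗ[Λ] (Fin n → Λ)) := by
  have := hM.finite
  have := hM.projective
  obtain ⟨n, f, hf⟩ := Module.Finite.exists_fin' Λ M
  obtain ⟨g, hg⟩ := Module.projective_lifting_property f LinearMap.id hf
  have hinj : Function.Injective g := fun x y h ↦ by
    have := congrArg f h
    rwa [← LinearMap.comp_apply, ← LinearMap.comp_apply, hg] at this
  have hc : IsCompl (LinearMap.range g) (LinearMap.ker f) := by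
    have hg' (x : M) : f (g x) = x := LinearMap.congr_fun hg x
    refine ⟨Submodule.disjoint_def.2 ?_, codisjoint_iff.2 (eq_top_iff.2 fun x _ ↦ ?_)⟩
    · rintro _ ⟨x, rfl⟩ hx
      rw [LinearMap.mem_ker, hg'] at hx
      rw [hx, map_zero]
    · refine Submodule.mem_sup.2 ⟨g (f x), ⟨_, rfl⟩, x - g (f x), ?_, by abel⟩
      rw [LinearMap.mem_ker, map_sub, hg', sub_self]
  let e : (M × LinearMap.ker f) ≃ₗ[Λ] (Fin n → Λ) :=
    ((LinearEquiv.ofInjective g hinj).prodCongr (LinearEquiv.refl Λ _)) ≪≫ₗ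
      Submodule.prodEquivOfIsCompl _ _ hc
  have : IsNoetherianRing Λ := IsNoetherianRing.of_finite O Λ
  have hpr : Module.Projective Λ (LinearMap.ker f) :=
    Module.Projective.of_split (e.toLinearMap ∘ₗ LinearMap.inr Λ M (LinearMap.ker f))
      (LinearMap.snd Λ _ _ ∘ₗ e.symm.toLinearMap) (by ext; simp)
  exact ⟨n, LinearMap.ker f, hM.of_prod_equiv e, ⟨e⟩⟩
end

/-- Bundled locally free `Λ`-modules. -/
structure LocallyFreeModule (O : Type*) (Λ : Type v) [CommRing O] [CommRing Λ] [Algebra O Λ] where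
  carrier : Type v
  [addCommGroup : AddCommGroup carrier]
  [module : Module Λ carrier]
  isLocallyFree : IsLocallyFree O Λ carrier

attribute [instance] LocallyFreeModule.addCommGroup LocallyFreeModule.module

section
variable (O : Type*) (Λ : Type v) [CommRing O] [CommRing Λ] [Algebra O Λ]

/-- `M` and `N` are stably isomorphic: `M ⊕ Λ^m ≅ N ⊕ Λ^n` for some `m`, `n`. -/
def StablyIsomorphic (M N : Type*) [AddCommGroup M] [Module Λ M] [AddCommGroup N]
    [Module Λ N] : Prop :=
  ∃ m n : ℕ, Nonempty ((M × (Fin m → Λ)) ≃ₗ[Λ] (N × (Fin n → Λ)))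

/-- The isomorphism `Λ^m ⊕ Λ^n ≅ Λ^(m+n)`. -/
def finAdd (m n : ℕ) : ((Fin m → Λ) × (Fin n → Λ)) ≃ₗ[Λ] (Fin (m + n) → Λ) :=
  (LinearEquiv.sumArrowLequivProdArrow (Fin m) (Fin n) Λ Λ).symm ≪≫ₗ
    LinearEquiv.funCongrLeft Λ Λ finSumFinEquiv.symm

variable {Λ} in
theorem StablyIsomorphic.trans {M N P : Type*} [AddCommGroup M] [Module Λ M] [AddCommGroup N]
    [Module Λ N] [AddCommGroup P] [Module Λ P] (h : StablyIsomorphic Λ M N)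
    (h' : StablyIsomorphic Λ N P) : StablyIsomorphic Λ M P := by
  obtain ⟨a, b, ⟨e⟩⟩ := h
  obtain ⟨c, d, ⟨f⟩⟩ := h'
  let e1 : (M × (Fin (a + c) → Λ)) ≃ₗ[Λ] (N × (Fin b → Λ)) × (Fin c → Λ) :=
    (LinearEquiv.refl Λ M).prodCongr (finAdd Λ a c).symm ≪≫ₗ
      (LinearEquiv.prodAssoc Λ M _ _).symm ≪≫ₗ e.prodCongr (LinearEquiv.refl Λ _)
  let e2 : ((N × (Fin b → Λ)) × (Fin c → Λ)) ≃ₗ[Λ] (N × (Fin c → Λ)) × (Fin b → Λ) :=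
    LinearEquiv.prodAssoc Λ N _ _ ≪≫ₗ
      (LinearEquiv.refl Λ N).prodCongr (LinearEquiv.prodComm Λ _ _) ≪≫ₗ
      (LinearEquiv.prodAssoc Λ N _ _).symm
  let e3 : ((N × (Fin c → Λ)) × (Fin b → Λ)) ≃ₗ[Λ] P × (Fin (d + b) → Λ) :=
    f.prodCongr (LinearEquiv.refl Λ _) ≪≫ₗ LinearEquiv.prodAssoc Λ P _ _ ≪≫ₗ
      (LinearEquiv.refl Λ P).prodCongr (finAdd Λ d b)
  exact ⟨a + c, d + b, ⟨e1 ≪≫ₗ e2 ≪≫ₗ e3⟩⟩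

variable {Λ} in
theorem StablyIsomorphic.symm {M N : Type*} [AddCommGroup M] [Module Λ M] [AddCommGroup N]
    [Module Λ N] (h : StablyIsomorphic Λ M N) : StablyIsomorphic Λ N M :=
  let ⟨m, n, ⟨e⟩⟩ := h
  ⟨n, m, ⟨e.symm⟩⟩

variable {Λ} in
theorem StablyIsomorphic.of_equiv {M N : Type*} [AddCommGroup M] [Module Λ M] [AddCommGroup N]
    [Module Λ N] (e : M ≃ₗ[Λ] N) : StablyIsomorphic Λ M N :=
  ⟨0, 0, ⟨e.prodCongr (LinearEquiv.refl Λ _)⟩⟩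

variable {Λ} in
theorem StablyIsomorphic.prod {M N M' N' : Type*} [AddCommGroup M] [Module Λ M] [AddCommGroup N]
    [Module Λ N] [AddCommGroup M'] [Module Λ M'] [AddCommGroup N'] [Module Λ N']
    (h : StablyIsomorphic Λ M N) (h' : StablyIsomorphic Λ M' N') :
    StablyIsomorphic Λ (M × M') (N × N') := by
  obtain ⟨a, b, ⟨e⟩⟩ := h
  obtain ⟨c, d, ⟨f⟩⟩ := h'
  exact ⟨a + c, b + d, ⟨(LinearEquiv.refl Λ _).prodCongr (finAdd Λ a c).symm ≪≫ₗ
    LinearEquiv.prodProdProdComm Λ M M' _ _ ≪≫ₗ e.prodCongr f ≪≫ₗ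
    LinearEquiv.prodProdProdComm Λ N _ N' _ ≪≫ₗ
    (LinearEquiv.refl Λ _).prodCongr (finAdd Λ b d)⟩⟩

/-- Stable isomorphism as an equivalence relation on locally free modules. -/
def stableSetoid : Setoid (LocallyFreeModule O Λ) where
  r M N := StablyIsomorphic Λ M.carrier N.carrier
  iseqv := ⟨fun _ ↦ .of_equiv (LinearEquiv.refl Λ _), fun h ↦ h.symm, fun h h' ↦ h.trans h'⟩

/-- The locally free class group `Cl(Λ)`: stable isomorphism classes of locally free `Λ`-modules,
with addition induced by the direct sum (see the instances below). -/
def LocallyFreeClassGroup : Type _ := Quotient (stableSetoid O Λ)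

variable {Λ} in
/-- The class of a locally free module in `Cl(Λ)`. -/
def stableClass {M : Type v} [AddCommGroup M] [Module Λ M] (hM : IsLocallyFree O Λ M) :
    LocallyFreeClassGroup O Λ :=
  Quotient.mk (stableSetoid O Λ) ⟨M, hM⟩

variable {O Λ} in
theorem stableClass_eq_iff {M N : Type v} [AddCommGroup M] [Module Λ M] [AddCommGroup N]
    [Module Λ N] (hM : IsLocallyFree O Λ M) (hN : IsLocallyFree O Λ N) :
    stableClass O hM = stableClass O hN ↔ StablyIsomorphic Λ M N :=
  Quotient.eq (r := stableSetoid O Λ)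

/-- The zero class is the class of `Λ`. -/
instance : Zero (LocallyFreeClassGroup O Λ) :=
  ⟨stableClass O (IsLocallyFree.of_free (M := Λ))⟩

/-- Addition is induced by the direct sum. -/
instance : Add (LocallyFreeClassGroup O Λ) :=
  ⟨Quotient.map₂ (fun M N ↦ ⟨M.carrier × N.carrier, M.isLocallyFree.prod N.isLocallyFree⟩)
    fun _ _ h _ _ h' ↦ StablyIsomorphic.prod h h'⟩

variable {O Λ} in
theorem exists_stableClass_add_eq_zero [IsNoetherianRing O] [Module.Finite O Λ]
    (a : LocallyFreeClassGroup O Λ) : ∃ b, b + a = 0 := by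
  induction a using Quotient.inductionOn with
  | h M =>
    obtain ⟨n, N, hN, ⟨e⟩⟩ := M.isLocallyFree.exists_compl
    refine ⟨stableClass O hN, Quotient.sound (s := stableSetoid O Λ) ⟨1, n, ⟨?_⟩⟩⟩
    exact (LinearEquiv.prodComm Λ N M.carrier ≪≫ₗ e).prodCongr
      (LinearEquiv.funUnique (Fin 1) Λ Λ) ≪≫ₗ LinearEquiv.prodComm Λ _ _

noncomputable instance [IsNoetherianRing O] [Module.Finite O Λ] :
    Neg (LocallyFreeClassGroup O Λ) :=
  ⟨fun a ↦ (exists_stableClass_add_eq_zero a).choose⟩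

noncomputable instance [IsNoetherianRing O] [Module.Finite O Λ] :
    AddCommGroup (LocallyFreeClassGroup O Λ) where
  add_assoc a b c := by
    induction a using Quotient.inductionOn
    induction b using Quotient.inductionOn
    induction c using Quotient.inductionOn
    exact Quotient.sound (s := stableSetoid O Λ) (.of_equiv (LinearEquiv.prodAssoc Λ _ _ _))
  zero_add a := by
    induction a using Quotient.inductionOn with
    | h M =>
      exact Quotient.sound (s := stableSetoid O Λ) ⟨0, 1, ⟨LinearEquiv.prodUnique ≪≫ₗ
        LinearEquiv.prodComm Λ _ _ ≪≫ₗ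
        (LinearEquiv.refl Λ _).prodCongr (LinearEquiv.funUnique (Fin 1) Λ Λ).symm⟩⟩
  add_zero a := by
    induction a using Quotient.inductionOn with
    | h M =>
      exact Quotient.sound (s := stableSetoid O Λ) ⟨0, 1, ⟨LinearEquiv.prodUnique ≪≫ₗ
        (LinearEquiv.refl Λ _).prodCongr (LinearEquiv.funUnique (Fin 1) Λ Λ).symm⟩⟩
  add_comm a b := by
    induction a using Quotient.inductionOn
    induction b using Quotient.inductionOn
    exact Quotient.sound (s := stableSetoid O Λ) (.of_equiv (LinearEquiv.prodComm Λ _ _))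
  nsmul := nsmulRec
  zsmul := zsmulRec
  neg_add_cancel a := (exists_stableClass_add_eq_zero a).choose_spec

variable {O Λ} in
theorem stableClass_add {M N : Type v} [AddCommGroup M] [Module Λ M] [AddCommGroup N]
    [Module Λ N] (hM : IsLocallyFree O Λ M) (hN : IsLocallyFree O Λ N) :
    stableClass O hM + stableClass O hN = stableClass O (hM.prod hN) := rfl

end

section

/-- An ideal that is locally generated by a non-zero-divisor is locally free. -/
theorem IsLocallyFree.of_ideal {O Λ : Type*} [CommRing O] [CommRing Λ] [Algebra O Λ]
    (I : Ideal Λ) (hI : I.FG)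
    (h : ∀ (q : Ideal O) [q.IsMaximal], ∃ a ∈ I, (∀ x, a * x = 0 → x = 0) ∧ ∃ s ∉ q,
      ∀ x ∈ I, a ∣ algebraMap O Λ s * x) : IsLocallyFree O Λ I := by
  refine ⟨Module.Finite.iff_fg.2 hI, fun q _ ↦ ?_⟩
  obtain ⟨a, ha, hreg, s, hs, hd⟩ := h q
  let f : Λ →ₗ[Λ] I := LinearMap.toSpanSingleton Λ I ⟨a, ha⟩
  have hf : Function.Injective f := (injective_iff_map_eq_zero f).2 fun x hx ↦ hreg x (by
    have := congrArg Subtype.val hx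
    simpa [f, mul_comm] using this)
  let F := LocalizedModule.map (locMonoid Λ q) f
  have hF : Function.Bijective F := by
    refine ⟨LocalizedModule.map_injective _ _ hf, fun y ↦ ?_⟩
    induction y using LocalizedModule.induction_on with
    | h y t =>
      obtain ⟨c, hc⟩ := hd y.1 y.2
      refine ⟨LocalizedModule.mk c (⟨algebraMap O Λ s, s, hs, rfl⟩ * t), ?_⟩
      rw [LocalizedModule.map_mk, LocalizedModule.mk_eq]
      refine ⟨1, ?_⟩
      apply Subtype.ext
      simp only [f, Submonoid.smul_def, one_smul, LinearMap.toSpanSingleton_apply,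
        SetLike.val_smul, smul_eq_mul, Submonoid.coe_mul]
      linear_combination (-(t : Λ)) * hc
  exact Module.Free.of_equiv ((LinearEquiv.ofBijective F hF))

variable (O G : Type*) [CommRing O] [CommGroup G] [Fintype G]

/-- The element `Σ = ∑ g` of the group ring `O[G]`. -/
noncomputable def groupSum : MonoidAlgebra O G := ∑ g : G, MonoidAlgebra.of O G g

variable {O} in
/-- The Swan module `⟨r, Σ⟩ = rΛ + ΛΣ`, an ideal of `Λ = O[G]`. -/
noncomputable def swanModule (r : O) : Ideal (MonoidAlgebra O G) :=
  Ideal.span {algebraMap O (MonoidAlgebra O G) r, groupSum O G}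

theorem groupSum_mul_self : groupSum O G * groupSum O G =
    algebraMap O _ (Fintype.card G : O) * groupSum O G := by
  have h (g : G) : MonoidAlgebra.of O G g * groupSum O G = groupSum O G := by
    rw [groupSum, Finset.mul_sum]
    simp_rw [← map_mul]
    exact Fintype.sum_equiv (Equiv.mulLeft g) _ _ fun _ ↦ rfl
  conv_lhs => rw [groupSum, Finset.sum_mul]; simp only [← groupSum.eq_1 O G, h]
  simp

end
open NumberField in
/-- Swan modules are locally free. -/
theorem isLocallyFree_swanModule (K G : Type*) [Field K] [NumberField K] [CommGroup G] [Fintype G]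
    (r : 𝓞 K) (hr : IsCoprime r (Fintype.card G : 𝓞 K)) :
    IsLocallyFree (𝓞 K) (MonoidAlgebra (𝓞 K) G) (swanModule G r) := by
  set n := Fintype.card G with hn
  set Λ := MonoidAlgebra (𝓞 K) G
  set σ : Λ := groupSum (𝓞 K) G with hσ
  have hσσ : σ * σ = algebraMap (𝓞 K) Λ n * σ := groupSum_mul_self (𝓞 K) G
  have hrI : algebraMap (𝓞 K) Λ r ∈ swanModule G r := Ideal.subset_span (Set.mem_insert _ _)
  have hσI : σ ∈ swanModule G r := Ideal.subset_span (Set.mem_insert_of_mem _ rfl)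
  have hn0 : (n : 𝓞 K) ≠ 0 := Nat.cast_ne_zero.2 Fintype.card_ne_zero
  have hdvd {a : Λ} {s : 𝓞 K} (h1 : a ∣ algebraMap (𝓞 K) Λ s * algebraMap (𝓞 K) Λ r)
      (h2 : a ∣ algebraMap (𝓞 K) Λ s * σ) (x : Λ) (hx : x ∈ swanModule G r) :
      a ∣ algebraMap (𝓞 K) Λ s * x := by
    obtain ⟨u, v, rfl⟩ := Ideal.mem_span_pair.1 hx
    rw [mul_add, mul_left_comm, mul_left_comm _ v]
    exact dvd_add (h1.mul_left _) (h2.mul_left _)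
  have hreg (c : 𝓞 K) (hc : c ≠ 0) (x : Λ) (hx : algebraMap (𝓞 K) Λ c * x = 0) : x = 0 := by
    rw [← Algebra.smul_def] at hx
    ext g
    have := congrArg (fun y : Λ ↦ y.coeff g) hx
    have h2 : c * x.coeff g = 0 := this
    exact congrArg _ ((mul_eq_zero.1 h2).resolve_left hc)
  have hfg : (swanModule G r).FG := Submodule.fg_span (Set.toFinite _)
  refine IsLocallyFree.of_ideal _ hfg fun q hq ↦ ?_
  by_cases hr0 : r = 0
  · have hu : IsUnit (n : ℤ) := by
      rw [hr0, isCoprime_zero_left] at hr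
      refine isUnit_of_map_unit (algebraMap ℤ (𝓞 K)) _ ?_
      simpa using hr
    have h1 : Fintype.card G = 1 := by simpa [Int.isUnit_iff] using Int.isUnit_iff_natAbs_eq.1 hu
    have hσ1 : σ = 1 := by
      have := (Fintype.card_le_one_iff_subsingleton.1 h1.le)
      rw [hσ, groupSum, Fintype.sum_subsingleton _ (1 : G), map_one]
    exact ⟨1, hσ1 ▸ hσI, (by simp), 1,
      (Ideal.ne_top_iff_one q).1 hq.ne_top, fun x _ ↦ one_dvd _⟩
  by_cases hrq : r ∈ q
  · have hnq : (n : 𝓞 K) ∉ q := fun h ↦ hq.ne_top (by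
      obtain ⟨u, v, huv⟩ := hr
      rw [Ideal.eq_top_iff_one, ← huv]
      exact q.add_mem (q.mul_mem_left _ hrq) (q.mul_mem_left _ h))
    set N := algebraMap (𝓞 K) Λ n
    set R := algebraMap (𝓞 K) Λ r
    refine ⟨R * (N - σ) + σ, Ideal.add_mem _ (Ideal.mul_mem_right _ _ hrI) hσI, ?_, n ^ 2,
      fun h ↦ hnq (hq.isPrime.mem_of_pow_mem _ h), hdvd ⟨N - σ + R * σ, ?_⟩ ⟨N * σ, ?_⟩⟩
    · refine fun x hx ↦
        hreg (n ^ 2 * r) (mul_ne_zero (pow_ne_zero _ hn0) hr0) x ?_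
      have e : algebraMap (𝓞 K) Λ (n ^ 2 * r) = N ^ 2 * R := by simp only [map_mul, map_pow, N, R]
      rw [e]
      linear_combination (N - σ + R * σ) * hx + (R ^ 2 + 1 - 2 * R) * x * hσσ
    · rw [map_pow]
      linear_combination (R ^ 2 + 1 - 2 * R) * hσσ
    · rw [map_pow]
      linear_combination (N * R - N) * hσσ
  · exact ⟨algebraMap (𝓞 K) Λ r, hrI, hreg r hr0, r, hrq,
      hdvd (dvd_mul_right _ _) (dvd_mul_right _ _)⟩

section
open NumberField
variable (K G : Type*) [Field K] [NumberField K] [CommGroup G] [Fintype G]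

/-- The locally free class group of the order `𝓞 K[G]`. -/
abbrev Cl : Type _ := LocallyFreeClassGroup (𝓞 K) (MonoidAlgebra (𝓞 K) G)

variable {K} in
/-- The class in `Cl(𝓞 K[G])` of the Swan module `⟨r, Σ⟩`, for `r` coprime to the order of `G`. -/
noncomputable def swanClass (r : 𝓞 K) (hr : IsCoprime r (Fintype.card G : 𝓞 K)) : Cl K G :=
  stableClass (𝓞 K) (isLocallyFree_swanModule K G r hr)

/-- The set of all classes of Swan modules. -/
def swanClasses : Set (Cl K G) :=
  {c | ∃ (r : 𝓞 K) (hr : IsCoprime r (Fintype.card G : 𝓞 K)), swanClass G r hr = c}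

/-- The Swan subgroup `T(𝓞 K[G])`, as the subgroup generated by the classes of Swan modules. -/
noncomputable def swanSubgroup : AddSubgroup (Cl K G) :=
  AddSubgroup.closure (swanClasses K G)

end

end SwanClass

/-! Write O for the ring of integers, ε for √-d, Γ = Λ/(Σ), and φ : Γ → O/p for the map induced by
the augmentation.

If r is the augmentation of some u invertible modulo Σ, multiplication by u carries ⟨r, Σ⟩ onto rΛ ≅
Λ (`swanModule_equiv_self`). Conversely, a stably free Swan module is a principal ideal, by a
determinant argument, and a generator produces such a u
(`exists_unit_of_swanModule_stablyIsomorphic`). The class of ⟨r, Σ⟩ is multiplicative in r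
(`swanModule_prod_equiv`) and depends only on r modulo p. Hence T(Λ) is (O/p)ˣ modulo the image of
Γˣ.

As p divides d, O/p = 𝔽_p[ε] with ε² = 0, and its units are the a(1 + ε)^n with a an integer prime
to p. The integers a come from the units (x^a - 1)/(x - 1) of Γ, x a generator of G. So T(Λ) is
generated by the class of 1 + ε, which p kills, and it remains to see that 1 + ε is not in φ(Γˣ)
(`not_exists_unit_of_aug_eq_one_add_root`).

Suppose φ(u) = 1 + ε. Then w = u/ū satisfies w w̄ = 1 and φ(w) = 1 + 2ε. A Kronecker-type finiteness
argument shows that w has finite order (`exists_pow_eq_one_of_mul_conj`). A power w^M with M prime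
to p has p-power order and φ(w^M) = 1 + 2Mε; congruences modulo p give (w^M)^p = 1. For p ≥ 5,
expansion in powers of π = x - 1 then forces φ(w^M) = 1. For p = 3 the cube roots of unity of Γ =
O[ω] are listed explicitly, which is where d ≠ 3 enters. So p divides 2M, a contradiction. -/

namespace SwanClass

/-! ### Augmentation, norm element and conjugation of O[G] -/

section GroupRing
variable {O G : Type*} [CommRing O] [CommGroup G]

/-- The augmentation `O[G] → O`. -/
noncomputable def aug (O G : Type*) [CommRing O] [CommGroup G] : MonoidAlgebra O G →ₐ[O] O :=
  MonoidAlgebra.lift O O G 1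

@[simp] theorem aug_of (g : G) : aug O G (MonoidAlgebra.of O G g) = 1 := by
  simp [aug]

@[simp] theorem aug_algebraMap (c : O) : aug O G (algebraMap O _ c) = c :=
  (aug O G).commutes c

@[simp] theorem coeff_algebraMap_mul (c : O) (x : MonoidAlgebra O G) (g : G) :
    (algebraMap O (MonoidAlgebra O G) c * x).coeff g = c * x.coeff g := by
  rw [← Algebra.smul_def]; rfl

theorem algebraMap_mul_eq_zero [IsDomain O] {c : O} (hc : c ≠ 0) {x : MonoidAlgebra O G}
    (hx : algebraMap O _ c * x = 0) : x = 0 := by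
  ext g
  have h : (algebraMap O _ c * x).coeff g = 0 := by rw [hx]; rfl
  rw [coeff_algebraMap_mul] at h
  exact (mul_eq_zero.1 h).resolve_left hc

/-- The semilinear involution of `O[G]` given by a ring endomorphism of `O` and the inversion
of `G`. -/
noncomputable def conj (G : Type*) [CommGroup G] (σ : O →+* O) :
    MonoidAlgebra O G →+* MonoidAlgebra O G :=
  MonoidAlgebra.liftNCRingHom ((algebraMap O _).comp σ)
    ((MonoidAlgebra.of O G).comp invMonoidHom) fun _ _ ↦ Commute.all _ _

@[simp] theorem conj_of (σ : O →+* O) (g : G) :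
    conj G σ (MonoidAlgebra.of O G g) = MonoidAlgebra.of O G g⁻¹ := by
  simp [conj]

@[simp] theorem conj_algebraMap (σ : O →+* O) (c : O) :
    conj G σ (algebraMap O _ c) = algebraMap O _ (σ c) := by
  simp [conj]

variable [Fintype G]

theorem sum_algebraMap_mul_of (x : MonoidAlgebra O G) :
    ∑ g : G, algebraMap O (MonoidAlgebra O G) (x.coeff g) * MonoidAlgebra.of O G g = x := by
  ext h
  simp [MonoidAlgebra.coeff_sum, MonoidAlgebra.coeff_single]

theorem aug_eq_sum (x : MonoidAlgebra O G) : aug O G x = ∑ g : G, x.coeff g := by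
  conv_lhs => rw [← sum_algebraMap_mul_of x]
  simp only [map_sum, map_mul, aug_of, aug_algebraMap, mul_one]

theorem of_mul_groupSum (g : G) :
    MonoidAlgebra.of O G g * groupSum O G = groupSum O G := by
  rw [groupSum, Finset.mul_sum]
  simp_rw [← map_mul]
  exact Fintype.sum_equiv (Equiv.mulLeft g) _ _ fun _ ↦ rfl

theorem mul_groupSum (x : MonoidAlgebra O G) :
    x * groupSum O G = algebraMap O _ (aug O G x) * groupSum O G := by
  conv_lhs => rw [← sum_algebraMap_mul_of x]
  rw [Finset.sum_mul, aug_eq_sum, map_sum, Finset.sum_mul]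
  exact Finset.sum_congr rfl fun g _ ↦ by rw [mul_assoc, of_mul_groupSum]

@[simp] theorem aug_groupSum : aug O G (groupSum O G) = Fintype.card G := by
  simp only [groupSum, map_sum, aug_of, Finset.sum_const, Finset.card_univ, nsmul_eq_mul, mul_one]

@[simp] theorem coeff_groupSum (g : G) : (groupSum O G).coeff g = 1 := by
  simp [groupSum, MonoidAlgebra.coeff_sum, Finsupp.finsetSum_apply, MonoidAlgebra.coeff_single]

theorem coeff_algebraMap_mul_groupSum (c : O) (g : G) :
    (algebraMap O (MonoidAlgebra O G) c * groupSum O G).coeff g = c := by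
  simp

theorem algebraMap_mul_groupSum_eq_zero {c : O}
    (h : algebraMap O (MonoidAlgebra O G) c * groupSum O G = 0) : c = 0 := by
  rw [← coeff_algebraMap_mul_groupSum c (1 : G), h]
  rfl

theorem mem_span_groupSum {x : MonoidAlgebra O G} :
    x ∈ Ideal.span {groupSum O G} ↔ ∃ c : O, x = algebraMap O _ c * groupSum O G := by
  rw [Ideal.mem_span_singleton']
  constructor
  · rintro ⟨a, rfl⟩
    exact ⟨_, mul_groupSum a⟩
  · rintro ⟨c, rfl⟩
    exact ⟨_, rfl⟩

/-- Every h is a power of g, so g - 1 divides each h - 1, and these span the augmentation ideal. -/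
theorem sub_one_dvd_of_aug_eq_zero {g : G} (hg : ∀ h : G, h ∈ Subgroup.zpowers g)
    {x : MonoidAlgebra O G} (hx : aug O G x = 0) : MonoidAlgebra.of O G g - 1 ∣ x := by
  have h1 (h : G) : MonoidAlgebra.of O G g - 1 ∣ MonoidAlgebra.of O G h - 1 := by
    obtain ⟨n, rfl⟩ := (mem_powers_iff_mem_zpowers (x := g)).2 (hg h)
    rw [map_pow]
    exact sub_one_dvd_pow_sub_one _ n
  have h2 : x = ∑ h : G, algebraMap O (MonoidAlgebra O G) (x.coeff h) *
      (MonoidAlgebra.of O G h - 1) := by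
    simp_rw [mul_sub, mul_one, Finset.sum_sub_distrib]
    rw [sum_algebraMap_mul_of, ← map_sum, ← aug_eq_sum, hx, map_zero, sub_zero]
  rw [h2]
  exact Finset.dvd_sum fun h _ ↦ (h1 h).mul_left _

theorem exists_eq_algebraMap_mul_groupSum_of_sub_one_mul {g : G}
    (hg : ∀ h : G, h ∈ Subgroup.zpowers g) {x : MonoidAlgebra O G}
    (hx : (MonoidAlgebra.of O G g - 1) * x = 0) :
    ∃ c : O, x = algebraMap O _ c * groupSum O G := by
  have hgx : MonoidAlgebra.of O G g * x = x := by linear_combination hx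
  have h (n : ℕ) : MonoidAlgebra.of O G g ^ n * x = x := by
    induction n with
    | zero => simp
    | succ n ih => rw [pow_succ, mul_assoc, hgx, ih]
  refine ⟨x.coeff 1, ?_⟩
  ext k
  obtain ⟨n, rfl⟩ := (mem_powers_iff_mem_zpowers (x := g)).2 (hg k)
  rw [coeff_algebraMap_mul_groupSum]
  conv_lhs => rw [← h n, ← map_pow]
  simp

theorem conj_groupSum (σ : O →+* O) : conj G σ (groupSum O G) = groupSum O G := by
  rw [groupSum, map_sum]
  simp_rw [conj_of]
  exact Fintype.sum_equiv (Equiv.inv G) _ _ fun _ ↦ rfl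

theorem aug_conj (σ : O →+* O) (x : MonoidAlgebra O G) :
    aug O G (conj G σ x) = σ (aug O G x) := by
  conv_lhs => rw [← sum_algebraMap_mul_of x]
  simp only [map_sum, map_mul, conj_of, conj_algebraMap, aug_of, aug_algebraMap, mul_one,
    aug_eq_sum x]

/-- For the conjugation of an imaginary quadratic order the right side is a sum of absolute squares;
this positivity bounds the coefficients in `exists_pow_eq_one_of_mul_conj`. -/
theorem coeff_one_mul_conj (σ : O →+* O) (x : MonoidAlgebra O G) :
    (x * conj G σ x).coeff 1 = ∑ g : G, x.coeff g * σ (x.coeff g) := by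
  have h : conj G σ x = ∑ g : G, algebraMap O _ (σ (x.coeff g)) * MonoidAlgebra.of O G g⁻¹ := by
    conv_lhs => rw [← sum_algebraMap_mul_of x]
    simp only [map_sum, map_mul, conj_of, conj_algebraMap]
  rw [h, Finset.mul_sum, MonoidAlgebra.coeff_sum, Finsupp.finsetSum_apply]
  refine Finset.sum_congr rfl fun g _ ↦ ?_
  rw [mul_left_comm, coeff_algebraMap_mul, mul_comm]
  simp

end GroupRing
end SwanClass
namespace SwanClass

/-! ### Stably free ideals are principal -/

section StablyFreeIdeal
variable {A : Type*} [CommRing A]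

/-- A stably free ideal containing a non-zero-divisor is principal. -/
theorem exists_eq_span_of_prod_equiv [Nontrivial A] (I : Ideal A) {r : A} (hr : r ∈ I)
    (hreg : ∀ x, r * x = 0 → x = 0) {m n : ℕ}
    (e : (I × (Fin m → A)) ≃ₗ[A] (Fin n → A)) : ∃ δ, I = Ideal.span {δ} := by
  let c : (A × (Fin m → A)) ≃ₗ[A] (Fin (m + 1) → A) := Fin.consLinearEquiv A (fun _ ↦ A)
  let j : (I × (Fin m → A)) →ₗ[A] (Fin (m + 1) → A) :=
    c.toLinearMap ∘ₗ (I.subtype.prodMap LinearMap.id)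
  have hj : Function.Injective j := by
    refine c.injective.comp ?_
    rintro ⟨x, y⟩ ⟨x', y'⟩ h
    simpa using h
  -- `ψ` embeds A^n in A^(m+1) with image I ⊕ A^m. Multiplication by the regular element r on the
  -- first coordinate embeds A^(m+1) back, so n = m + 1.
  let ψ : (Fin n → A) →ₗ[A] (Fin (m + 1) → A) := j ∘ₗ e.symm.toLinearMap
  have h1 : n ≤ m + 1 := le_of_fin_injective A ψ (hj.comp e.symm.injective)
  let mulI (x : A) (hx : x ∈ I) : (Fin (m + 1) → A) →ₗ[A] (Fin n → A) :=
    e.toLinearMap ∘ₗ ((LinearMap.toSpanSingleton A I ⟨x, hx⟩).prodMap LinearMap.id) ∘ₗ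
      c.symm.toLinearMap
  have h2 : m + 1 ≤ n := by
    refine le_of_fin_injective A (mulI r hr) (e.injective.comp (Function.Injective.comp
      (g := (LinearMap.toSpanSingleton A I ⟨r, hr⟩).prodMap LinearMap.id) ?_ c.symm.injective))
    rintro ⟨x, y⟩ ⟨x', y'⟩ h
    simp only [LinearMap.prodMap_apply, Prod.mk.injEq, LinearMap.toSpanSingleton_apply,
      LinearMap.id_coe, id_eq, Subtype.ext_iff, SetLike.val_smul, smul_eq_mul] at h
    refine Prod.ext ?_ h.2
    rw [← sub_eq_zero]
    exact hreg _ (by linear_combination h.1)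
  obtain rfl : n = m + 1 := le_antisymm h1 h2
  -- For x in I, the matrix diag(x, 1, …, 1) factors through `ψ`, so det ψ divides x. Conversely the
  -- first row of `ψ` has its entries in I, and so has the determinant expanded along it.
  refine ⟨LinearMap.det ψ, le_antisymm (fun x hx ↦ ?_) ?_⟩
  · rw [Ideal.mem_span_singleton]
    have hD : ψ ∘ₗ mulI x hx = Matrix.toLin' (Matrix.diagonal (Fin.cons x fun _ ↦ 1)) := by
      refine LinearMap.ext fun v ↦ funext fun i ↦ ?_
      have : (ψ ∘ₗ mulI x hx) v = Fin.cons (v 0 * x) (Fin.tail v) := by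
        simp [ψ, mulI, j, c, Fin.tail_def]
        rfl
      rw [this, Matrix.toLin'_apply, Matrix.mulVec_diagonal]
      refine Fin.cases ?_ (fun i ↦ ?_) i
      · simp [mul_comm]
      · simp [Fin.tail]
    have hd := congrArg LinearMap.det hD
    rw [LinearMap.det_comp, LinearMap.det_toLin', Matrix.det_diagonal, Fin.prod_univ_succ] at hd
    simp only [Fin.cons_zero, Fin.cons_succ, Finset.prod_const_one, mul_one] at hd
    exact ⟨_, hd.symm⟩
  · rw [Ideal.span_singleton_le_iff_mem, ← LinearMap.det_toMatrix', Matrix.det_succ_row_zero]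
    refine Ideal.sum_mem _ fun i _ ↦ Ideal.mul_mem_right _ _ (Ideal.mul_mem_left _ _ ?_)
    rw [LinearMap.toMatrix'_apply]
    exact (e.symm (Pi.single i 1)).1.2

end StablyFreeIdeal

/-! ### Sums and triviality of Swan modules -/

section Swan
variable {O G : Type*} [CommRing O] [CommGroup G] [Fintype G]

theorem mem_swanModule {r : O} {x : MonoidAlgebra O G} : x ∈ swanModule G r ↔
    ∃ (y : MonoidAlgebra O G) (c : O),
      x = algebraMap O _ r * y + algebraMap O _ c * groupSum O G := by
  rw [swanModule, Ideal.mem_span_pair]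
  constructor
  · rintro ⟨a, b, rfl⟩
    exact ⟨a, aug O G b, by rw [← mul_groupSum, mul_comm a]⟩
  · rintro ⟨y, c, rfl⟩
    exact ⟨y, algebraMap O _ c, by rw [mul_comm y]⟩

/-- Both sides embed in Λ², with the same image rΛ × ⟨rs, Σ⟩: the right side by diag(r, 1), the left
side by a matrix which is diag(1, r) modulo Σ. Its Σ-terms are chosen so that the determinant is
exactly r, since Σ² = nΣ; the adjugate then gives injectivity. -/
theorem swanModule_prod_equiv [IsDomain O] {r q t : O} (s : O) (hr : r ≠ 0)
    (h : r * q = 1 + Fintype.card G * t) :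
    Nonempty ((swanModule G r × swanModule G s) ≃ₗ[MonoidAlgebra O G]
      (MonoidAlgebra O G × swanModule G (r * s))) := by
  set Λ := MonoidAlgebra O G
  set n : O := ((Fintype.card G : ℕ) : O) with hn
  let C : O →+* Λ := algebraMap O Λ
  let S : Λ := groupSum O G
  have hC : C r * C q = 1 + C n * C t := by rw [← map_mul, h]; simp
  have hS : S * S = C n * S := groupSum_mul_self O G
  have hreg (x : Λ) (hx : C r * x = 0) : x = 0 := algebraMap_mul_eq_zero hr hx
  let i := (swanModule G r).subtype ∘ₗ LinearMap.fst Λ (swanModule G r) (swanModule G s)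
  let j := (swanModule G s).subtype ∘ₗ LinearMap.snd Λ (swanModule G r) (swanModule G s)
  let f := ((1 - C n * C t ^ 2 * S) • i + (C r * C t * S) • j).prod
    ((-(C t * S)) • i + C r • j)
  let g := (C r • LinearMap.fst Λ Λ (swanModule G (r * s))).prod
    ((swanModule G (r * s)).subtype ∘ₗ LinearMap.snd Λ Λ (swanModule G (r * s)))
  have hf1 (x) : (f x).1 = (1 - C n * C t ^ 2 * S) * x.1 + C r * C t * S * x.2 := rfl
  have hf2 (x) : (f x).2 = -(C t * S) * x.1 + C r * x.2 := rfl
  have hg1 (x) : (g x).1 = C r * x.1 := rfl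
  have hg2 (x) : (g x).2 = x.2 := rfl
  have hfi : Function.Injective f := by
    refine (injective_iff_map_eq_zero f).2 fun x hx ↦ ?_
    have h1 := congrArg Prod.fst hx
    have h2 := congrArg Prod.snd hx
    rw [hf1, Prod.fst_zero] at h1
    rw [hf2, Prod.snd_zero] at h2
    refine Prod.ext (Subtype.ext (hreg _ ?_)) (Subtype.ext (hreg _ ?_))
    · linear_combination C r * h1 - C r * C t * S * h2 - C r * C t ^ 2 * x.1.1 * hS
    · linear_combination (1 - C n * C t ^ 2 * S) * h2 + C t * S * h1 - C r * C t ^ 2 * x.2.1 * hS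
  have hgi : Function.Injective g := by
    refine (injective_iff_map_eq_zero g).2 fun x hx ↦ ?_
    have h1 := congrArg Prod.fst hx
    have h2 := congrArg Prod.snd hx
    exact Prod.ext (hreg _ h1) (Subtype.ext h2)
  have hrange : LinearMap.range f = LinearMap.range g := by
    apply le_antisymm
    · rintro _ ⟨⟨⟨x, hx⟩, ⟨y, hy⟩⟩, rfl⟩
      obtain ⟨a, m, rfl⟩ := mem_swanModule.1 hx
      obtain ⟨b, k, rfl⟩ := mem_swanModule.1 hy
      change C r * a + C m * S ∈ _ at hx
      change C s * b + C k * S ∈ _ at hy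
      have ha := mul_groupSum a
      have hb := mul_groupSum b
      change a * S = C _ * S at ha
      change b * S = C _ * S at hb
      refine ⟨⟨a + C m * C q * (1 - C n * C t) * S - C n * C t ^ 2 * S * a
        + C t * S * (C s * b + C k * S), ⟨-(C t * S) * (C r * a + C m * S) +
          C r * (C s * b + C k * S), ?_⟩⟩, ?_⟩
      · refine mem_swanModule.2 ⟨b, -(t * r * aug O G a) - t * m * n + r * k, ?_⟩
        change _ = C (r * s) * b + C (-(t * r * aug O G a) - t * m * n + r * k) * S
        simp only [map_mul, map_add, map_neg, map_sub]
        linear_combination (-(C t * C r)) * ha - C t * C m * hS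
      · refine Prod.ext ?_ (by rw [hg2, hf2])
        rw [hg1, hf1]
        linear_combination (C m * S * (1 - C n * C t)) * hC + C n * C t ^ 2 * C m * hS
    · rintro _ ⟨⟨x, ⟨y, hy⟩⟩, rfl⟩
      obtain ⟨b, k, rfl⟩ := mem_swanModule.1 hy
      change C (r * s) * b + C k * S ∈ _ at hy
      have hx := mul_groupSum x
      have hb := mul_groupSum b
      change x * S = C _ * S at hx
      change b * S = C _ * S at hb
      refine ⟨⟨⟨C r * x - C t * S * (C (r * s) * b + C k * S), ?_⟩,
        ⟨C t * S * x + C s * b + C k * C q * (1 - C n * C t) * S -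
          C n * C t ^ 2 * C s * b * S, ?_⟩⟩, ?_⟩
      · refine mem_swanModule.2 ⟨x, -(t * (r * s * aug O G b + k * n)), ?_⟩
        change _ = C r * x + C (-(t * (r * s * aug O G b + k * n))) * S
        simp only [map_mul, map_add, map_neg]
        linear_combination (-(C t * C r * C s)) * hb - C t * C k * hS
      · refine mem_swanModule.2 ⟨b, t * aug O G x + k * q * (1 - n * t) -
          n * t ^ 2 * s * aug O G b, ?_⟩
        change _ = C s * b + C (t * aug O G x + k * q * (1 - n * t) -
          n * t ^ 2 * s * aug O G b) * S
        simp only [map_mul, map_add, map_sub, map_pow, map_one]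
        linear_combination C t * hx - (C n * C t ^ 2 * C s) * hb
      · refine Prod.ext ?_ ?_
        · rw [hg1, hf1]
          simp only [map_mul]
          linear_combination (C r * C t ^ 2 * x + C n * C t ^ 3 * C k * S) * hS +
            C t * C k * (1 - C n * C t) * S ^ 2 * hC
        · rw [hg2, hf2]
          simp only [map_mul]
          linear_combination (C t ^ 2 * C r * C s * b + C t ^ 2 * C k * (S + C n)) * hS +
            C k * (1 - C n * C t) * S * hC
  exact ⟨LinearEquiv.ofInjective f hfi ≪≫ₗ LinearEquiv.ofEq _ _ hrange ≪≫ₗ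
    (LinearEquiv.ofInjective g hgi).symm⟩

/-- Multiplication by u maps ⟨r, Σ⟩ onto rΛ: uΣ = rΣ puts the image inside, and v, inverse to u up
to a multiple of Σ, gives surjectivity. -/
theorem swanModule_equiv_self [IsDomain O] {r c : O} (hr : r ≠ 0) {u v : MonoidAlgebra O G}
    (huv : u * v = 1 + algebraMap O _ c * groupSum O G) (hu : aug O G u = r) :
    Nonempty (swanModule G r ≃ₗ[MonoidAlgebra O G] MonoidAlgebra O G) := by
  let Λ := MonoidAlgebra O G
  let C : O →+* Λ := algebraMap O Λ
  let S : Λ := groupSum O G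
  have huS : u * S = C r * S := by rw [← hu]; exact mul_groupSum u
  change u * v = 1 + C c * S at huv
  let f := u • (swanModule G r).subtype
  let g := C r • (LinearMap.id : Λ →ₗ[Λ] Λ)
  have hf (x) : f x = u * x := rfl
  have hg (x) : g x = C r * x := rfl
  have hfi : Function.Injective f := by
    refine (injective_iff_map_eq_zero f).2 fun ⟨x, hx'⟩ hx ↦ Subtype.ext ?_
    rw [hf] at hx
    change u * x = 0 at hx
    change x = 0
    have hxS := mul_groupSum x
    change x * S = C _ * S at hxS
    have h1 : x = - (C c * C (aug O G x) * S) := by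
      linear_combination v * hx - x * huv - C c * hxS
    have h2 : C r * x = 0 := by
      rw [h1] at hx ⊢
      linear_combination hx + C c * C (aug O G x) * huS
    exact algebraMap_mul_eq_zero hr h2
  have hgi : Function.Injective g :=
    (injective_iff_map_eq_zero g).2 fun x hx ↦ algebraMap_mul_eq_zero hr hx
  have hrange : LinearMap.range f = LinearMap.range g := by
    apply le_antisymm
    · rintro _ ⟨⟨x, hx⟩, rfl⟩
      obtain ⟨a, m, rfl⟩ := mem_swanModule.1 hx
      refine ⟨u * a + C m * S, ?_⟩
      rw [hf, hg]
      change C r * (u * a + C m * S) = u * (C r * a + C m * S)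
      linear_combination (-C m) * huS
    · rintro _ ⟨x, rfl⟩
      have hxS := mul_groupSum x
      change x * S = C _ * S at hxS
      refine ⟨⟨C r * (v * x) - C (c * aug O G x) * S, mem_swanModule.2
        ⟨v * x, -(c * aug O G x), by rw [map_neg]; ring⟩⟩, ?_⟩
      rw [hf, hg]
      change u * (C r * (v * x) - C (c * aug O G x) * S) = _
      rw [map_mul]
      linear_combination C r * x * huv + C r * C c * hxS - C c * C (aug O G x) * huS
  exact ⟨LinearEquiv.ofInjective f hfi ≪≫ₗ LinearEquiv.ofEq _ _ hrange ≪≫ₗ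
    (LinearEquiv.ofInjective g hgi).symm⟩

theorem exists_eq_of_algebraMap_mul_eq [IsDomain O] {r a : O} (hr : r ≠ 0)
    {x : MonoidAlgebra O G} (h : algebraMap O _ r * x = algebraMap O _ a * groupSum O G) :
    ∃ b : O, x = algebraMap O _ b * groupSum O G := by
  refine ⟨x.coeff 1, ?_⟩
  have h1 : a = r * x.coeff 1 := by
    rw [← coeff_algebraMap_mul, h, coeff_algebraMap_mul_groupSum]
  rw [← sub_eq_zero]
  refine algebraMap_mul_eq_zero hr ?_
  rw [mul_sub, h, h1, map_mul]
  ring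

/-- A generator δ = rl + kΣ of ⟨r, Σ⟩ divides both r and Σ. From r = δv it follows that lv ≡ 1
modulo Σ, and from Σ = δw that w is a multiple of Σ and the augmentation of δ is a unit of O. -/
theorem exists_unit_of_swanModule_stablyIsomorphic [IsDomain O] {r : O} (hr : r ≠ 0)
    (h : StablyIsomorphic (MonoidAlgebra O G) (swanModule G r) (MonoidAlgebra O G)) :
    ∃ (u v : MonoidAlgebra O G) (c : O), u * v = 1 + algebraMap O _ c * groupSum O G ∧
      aug O G u = r := by
  let Λ := MonoidAlgebra O G
  let C : O →+* Λ := algebraMap O Λ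
  let S : Λ := groupSum O G
  have hreg (x : Λ) (hx : C r * x = 0) : x = 0 := algebraMap_mul_eq_zero hr hx
  have hrI : C r ∈ swanModule G r := Ideal.subset_span (Set.mem_insert _ _)
  have hSI : S ∈ swanModule G r := Ideal.subset_span (Set.mem_insert_of_mem _ rfl)
  obtain ⟨m, n, ⟨e⟩⟩ := h
  obtain ⟨δ, hδ⟩ := exists_eq_span_of_prod_equiv (swanModule G r) hrI hreg
    (e ≪≫ₗ Fin.consLinearEquiv Λ (fun _ ↦ Λ))
  obtain ⟨l, k, hl⟩ := mem_swanModule.1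
    (hδ.symm ▸ Ideal.mem_span_singleton_self δ : δ ∈ swanModule G r)
  change δ = C r * l + C k * S at hl
  obtain ⟨v, hv⟩ := Ideal.mem_span_singleton.1 (hδ ▸ hrI)
  obtain ⟨w, hw⟩ := Ideal.mem_span_singleton.1 (hδ ▸ hSI)
  have hvS : v * S = C (aug O G v) * S := mul_groupSum v
  have hwS : w * S = C (aug O G w) * S := mul_groupSum w
  have hδS : δ * S = C (aug O G δ) * S := mul_groupSum δ
  have hav : r = aug O G δ * aug O G v := by
    have := congrArg (aug O G) hv
    rwa [map_mul, aug_algebraMap] at this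
  obtain ⟨c, hc⟩ : ∃ c, l * v - 1 = C c * S := by
    refine exists_eq_of_algebraMap_mul_eq (a := -(k * aug O G v)) hr ?_
    change C r * (l * v - 1) = C _ * S
    rw [map_neg, map_mul]
    linear_combination (-1 : Λ) * hv - v * hl - C k * hvS
  obtain ⟨c', hc'⟩ : ∃ c', w = C c' * S := by
    refine exists_eq_of_algebraMap_mul_eq
      (a := aug O G v * (1 - k * aug O G w) - r * c * aug O G w) hr ?_
    change C r * w = C _ * S
    simp only [map_mul, map_sub, map_one]
    linear_combination (-(C r * w)) * hc - v * hw - v * w * hl - C r * C c * hwS -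
      C k * v * hwS + (1 - C k * C (aug O G w)) * hvS
  have hu : aug O G δ * c' = 1 := by
    rw [← sub_eq_zero]
    refine algebraMap_mul_groupSum_eq_zero (G := G) ?_
    change C _ * S = 0
    simp only [map_mul, map_sub, map_one]
    linear_combination (-(δ * hc')) - hw - C c' * hδS
  have hu' : C (aug O G δ) * C c' = 1 := by rw [← map_mul, hu, map_one]
  -- `v` is invertible modulo Σ, but r is its augmentation times that of `δ`. Scaling by the unit
  -- `aug O G δ`, whose inverse is `c'`, corrects this.
  refine ⟨C (aug O G δ) * v, C c' * l, c, ?_, ?_⟩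
  · change C (aug O G δ) * v * (C c' * l) = 1 + C c * S
    linear_combination v * l * hu' + hc
  · rw [map_mul, hav]
    exact congrArg (· * _) (aug_algebraMap _)

end Swan
end SwanClass
namespace SwanClass

/-! ### Elements of p-power order in a p-torsion-free, p-adically separated ring -/

section Torsion
open Polynomial in
-- The middle binomial terms are divisible by p, and the linear one is exactly pz. The identity is
-- obtained in ℤ[X], where X and p can be cancelled, and then specialised.
theorem exists_one_add_pow_prime_eq {p : ℕ} (hp : p.Prime) {C : Type*} [CommRing C] (z : C) :
    ∃ t : C, (1 + z) ^ p = 1 + z ^ p + p * z * (1 + z * t) := by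
  obtain ⟨r, hr⟩ := exists_add_pow_prime_eq hp (1 : ℤ[X]) X
  obtain ⟨k, hk⟩ := Polynomial.powAddExpansion (1 : ℤ[X]) X p
  obtain ⟨m, rfl⟩ : ∃ m, p = m + 2 := ⟨p - 2, by have := hp.two_le; omega⟩
  have h1 : (X : ℤ[X]) * (((m + 2 : ℕ) : ℤ[X]) * (r - 1) - X * (k - X ^ m)) = 0 := by
    have h := hr.symm.trans hk
    simp only [one_pow, mul_one] at h
    linear_combination h
  have h2 := congrArg (eval 0) ((mul_eq_zero.1 h1).resolve_left X_ne_zero)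
  have h3 : eval 0 r - 1 = 0 := by
    simp only [eval_sub, eval_mul, eval_natCast, eval_one, eval_X, zero_mul, sub_zero,
      eval_zero] at h2
    exact (mul_eq_zero.1 h2).resolve_left (by positivity)
  obtain ⟨t, ht⟩ : X ∣ r - 1 := by
    rw [X_dvd_iff, coeff_zero_eq_eval_zero, eval_sub, eval_one, h3]
  refine ⟨aeval z t, ?_⟩
  have h4 := congrArg (aeval z) hr
  have h5 := congrArg (aeval z) ht
  simp only [map_pow, map_add, map_mul, map_one, aeval_X, map_natCast, map_sub, one_pow,
    mul_one] at h4 h5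
  rw [h4]
  linear_combination ((m + 2 : ℕ) : C) * z * h5

variable {C : Type*} [CommRing C] {p : ℕ}

/-- Expanding x^p around 1 and cancelling p gives x - 1 = p(x - 1)(⋯), so every power of p divides x
- 1. The term (x - 1)^p is harmless because p - 1 ≥ 2. -/
theorem eq_one_of_pow_eq_one_of_dvd_sub_one (hp : p.Prime) (hp2 : 2 < p)
    (htf : ∀ x : C, (p : C) * x = 0 → x = 0)
    (hsep : ∀ x : C, (∀ n : ℕ, (p : C) ^ n ∣ x) → x = 0)
    {x : C} (hx : x ^ p = 1) (hd : (p : C) ∣ x - 1) : x = 1 := by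
  obtain ⟨z, hz⟩ := hd
  obtain ⟨t, ht⟩ := exists_one_add_pow_prime_eq hp (x - 1)
  obtain ⟨m, rfl⟩ : ∃ m, p = m + 3 := ⟨p - 3, by omega⟩
  set q : C := ((m + 3 : ℕ) : C)
  rw [add_sub_cancel, hx] at ht
  have h1 : (x - 1) = q * ((x - 1) * -(z * t + q ^ m * z ^ (m + 2))) := by
    have h2 : q * ((x - 1) * (1 + (x - 1) * t + q ^ m * (q * z ^ (m + 2)))) = 0 := by
      have e : (x - 1) ^ (m + 3) = (x - 1) * (q ^ m * (q * z ^ (m + 2))) * q := by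
        rw [pow_succ' (x - 1) (m + 2)]
        conv_lhs => rw [hz]
        rw [hz]
        ring
      linear_combination -e - ht
    have h3 := htf _ h2
    linear_combination h3 - (x - 1) * t * hz
  rw [← sub_eq_zero]
  refine hsep _ fun n ↦ ?_
  induction n with
  | zero => simp
  | succ n ih =>
    rw [pow_succ', h1]
    exact mul_dvd_mul_left _ (ih.mul_right _)

theorem eq_one_of_pow_prime_pow_eq_one (hp : p.Prime) (hp2 : 2 < p)
    (htf : ∀ x : C, (p : C) * x = 0 → x = 0)
    (hsep : ∀ x : C, (∀ n : ℕ, (p : C) ^ n ∣ x) → x = 0) (k : ℕ)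
    {x : C} (hx : x ^ p ^ k = 1) (hd : (p : C) ∣ x - 1) : x = 1 := by
  induction k with
  | zero => simpa using hx
  | succ k ih =>
    refine ih (eq_one_of_pow_eq_one_of_dvd_sub_one hp hp2 htf hsep ?_
      (hd.trans (sub_one_dvd_pow_sub_one _ _)))
    rw [← pow_mul, ← pow_succ, hx]

variable {R : Type*} [CommRing R] (φ : C →+* R) {π ε : C}

/-- With w = 1 + cε + πy, both (cε)^p and (πy)^p are divisible by p, so w^p ≡ 1 modulo p; being of
p-power order, w^p equals 1. -/
theorem pow_prime_eq_one_of_map_eq (hp : p.Prime) (hp2 : 2 < p)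
    (htf : ∀ x : C, (p : C) * x = 0 → x = 0)
    (hsep : ∀ x : C, (∀ n : ℕ, (p : C) ^ n ∣ x) → x = 0)
    (hker : ∀ x, φ x = 0 → π ∣ x) (hε : (p : C) ∣ ε ^ 2) (hπ : (p : C) ∣ π ^ (p - 1))
    {w : C} {k : ℕ} (hw : w ^ p ^ k = 1) {c : ℤ} (hc : φ w = 1 + c * φ ε) : w ^ p = 1 := by
  obtain ⟨y, hy⟩ := hker (w - 1 - c * ε) (by simp [hc])
  have hw' : w = 1 + (c * ε + π * y) := by linear_combination hy
  refine eq_one_of_pow_prime_pow_eq_one hp hp2 htf hsep k ?_ ?_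
  · rw [pow_right_comm, hw, one_pow]
  · obtain ⟨r, hr⟩ := exists_add_pow_prime_eq hp 1 (c * ε + π * y)
    obtain ⟨s, hs⟩ := exists_add_pow_prime_eq hp (c * ε) (π * y)
    have h1 : (p : C) ∣ (c * ε) ^ p := by
      rw [mul_pow]
      exact (hε.trans (pow_dvd_pow _ hp2.le)).mul_left _
    have h2 : (p : C) ∣ (π * y) ^ p := by
      rw [mul_pow]
      exact (hπ.trans (pow_dvd_pow _ (Nat.sub_le _ _))).mul_right _
    rw [hw', hr, hs, one_pow]
    have : 1 + ((c * ε) ^ p + (π * y) ^ p + p * (c * ε) * (π * y) * s) +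
        p * 1 * (c * ε + π * y) * r - 1 = (c * ε) ^ p + (π * y) ^ p +
        p * ((c * ε) * (π * y) * s + (c * ε + π * y) * r) := by ring
    rw [this]
    exact dvd_add (dvd_add h1 h2) (dvd_mul_right _ _)

/-- After multiplication by a power of ζ = 1 + π, w becomes 1 + z with z = εA + π²B. Then z² = π²q
with φ(q) a multiple of φ(ε), and (1 + z)^p = 1 reduces to z(1 + zt' - (1 + πt)q^((p-1)/2)) = 0.
Applying φ, with φ(ε)² = 0, leaves cφ(ε) = 0. -/
theorem map_eq_one_of_pow_prime_eq_one (hp : p.Prime) (hp5 : 5 ≤ p)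
    (htf : ∀ x : C, (p : C) * x = 0 → x = 0) (hpR : (p : R) = 0)
    (hφπ : φ π = 0) (hker : ∀ x, φ x = 0 → π ∣ x)
    (hrep : ∀ x : C, ∃ a b : ℤ, φ x = a + b * φ ε)
    (hε : (p : C) ∣ ε ^ 2) (hπ : ∃ t, π ^ (p - 1) = -(p * (1 + π * t)))
    (hζ : (1 + π) ^ p = 1) {w : C} (hw : w ^ p = 1) {c : ℤ} (hc : φ w = 1 + c * φ ε) :
    φ w = 1 := by
  obtain ⟨y, hy⟩ := hker (w - 1 - c * ε) (by simp [hc])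
  obtain ⟨a, j, haj⟩ := hrep y
  -- This exponent makes ζ^i = 1 + iπ + eπ² cancel the integer part a of the coefficient of π in w.
  obtain ⟨i, hi⟩ : ∃ i : ℕ, (i : R) = -a := by
    refine ⟨(-a % p).toNat, ?_⟩
    have h0 : 0 ≤ -a % p := Int.emod_nonneg _ (by exact_mod_cast hp.ne_zero)
    have h1 : ((-a % p).toNat : ℤ) = -a - p * (-a / p) := by
      rw [Int.toNat_of_nonneg h0, Int.emod_def]
    have h2 := congrArg (Int.cast (R := R)) h1
    push_cast at h2
    rw [h2, hpR]
    ring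
  obtain ⟨y', hy'⟩ := hker (y + i - j * ε) (by simp [haj, hi])
  obtain ⟨e, he⟩ := Polynomial.powAddExpansion 1 π i
  simp only [one_pow, mul_one] at he
  obtain ⟨s, hs⟩ := hε
  obtain ⟨t, ht⟩ := hπ
  obtain ⟨p4, hp4⟩ : π ^ 4 ∣ (p : C) := by
    have h1 : π ^ 4 ∣ π ^ (p - 1) := pow_dvd_pow _ (by omega)
    -- A truncated geometric series inverts 1 + πt up to (πt)⁴; p - 1 ≥ 4 then gives π⁴ ∣ p.
    have h2 : (p : C) = -π ^ (p - 1) * (1 - π * t + (π * t) ^ 2 - (π * t) ^ 3) +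
        π ^ 4 * (p * t ^ 4) := by rw [ht]; ring
    rw [h2]
    exact dvd_add ((h1.neg_right).mul_right _) (dvd_mul_right _ _)
  obtain ⟨A, hA⟩ : ∃ A, A = (c + j * π) * (1 + i * π + e * π ^ 2) := ⟨_, rfl⟩
  obtain ⟨B, hB⟩ : ∃ B, B = e - i ^ 2 - i * e * π + y' * (1 + i * π + e * π ^ 2) := ⟨_, rfl⟩
  obtain ⟨z, hz⟩ : ∃ z, z = ε * A + π ^ 2 * B := ⟨_, rfl⟩
  have hw1 : w * (1 + π) ^ i = 1 + z := by
    rw [he, hz, hA, hB]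
    linear_combination (1 + i * π + e * π ^ 2) * hy + π * (1 + i * π + e * π ^ 2) * hy'
  have hzp : (1 + z) ^ p = 1 := by
    rw [← hw1, mul_pow, hw, pow_right_comm, hζ, one_pow, one_mul]
  have hφε : φ ε * φ ε = 0 := by
    rw [← map_mul, ← pow_two, hs, map_mul, map_natCast, hpR, zero_mul]
  have hφz : φ z = c * φ ε := by
    simp only [hz, hA, map_add, map_mul, map_pow, map_intCast, map_natCast, map_one, hφπ]
    ring
  -- Since ε² = ps is divisible by π⁴, the ε²-term still carries π² after division by π², and φ
  -- kills it.
  obtain ⟨q, hq⟩ : ∃ q, q = π ^ 2 * (p4 * s * A ^ 2) + 2 * ε * A * B + π ^ 2 * B ^ 2 := ⟨_, rfl⟩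
  have hzq : z ^ 2 = π ^ 2 * q := by
    rw [hz, hq]
    linear_combination A ^ 2 * hs + A ^ 2 * s * hp4
  obtain ⟨t', ht'⟩ := exists_one_add_pow_prime_eq hp z
  rw [hzp] at ht'
  obtain ⟨h, hh⟩ : ∃ h, p = 2 * (h + 1) + 1 := by
    obtain ⟨h, hh⟩ := hp.odd_of_ne_two (by omega)
    exact ⟨h - 1, by omega⟩
  have hzp' : z ^ p = -(p * (z * ((1 + π * t) * q ^ (h + 1)))) := by
    have : p - 1 = 2 * (h + 1) := by omega
    rw [this, pow_mul] at ht
    have e1 : z ^ p = z * (z ^ 2) ^ (h + 1) := by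
      rw [← pow_mul, ← pow_succ', ← hh]
    rw [e1, hzq, mul_pow]
    linear_combination z * q ^ (h + 1) * ht
  have h1 : z * (1 + z * t' - (1 + π * t) * q ^ (h + 1)) = 0 := by
    refine htf _ ?_
    linear_combination -hzp' - ht'
  have h2 := congrArg φ h1
  have hφq : φ q = 2 * φ ε * φ A * φ B := by
    simp only [hq, map_add, map_mul, map_pow, map_ofNat, hφπ]
    ring
  rw [map_mul, map_sub, map_mul, map_pow, hφq, map_add, map_mul, hφz, map_zero, map_one,
    pow_succ] at h2
  rw [hc]
  linear_combination h2 - ((c : R) ^ 2 * φ t') * hφε +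
    c * φ (1 + π * t) * (2 * φ ε * φ A * φ B) ^ h * (2 * φ A * φ B) * hφε

/-- A cube root of unity in `O[ω]` lies in `{1, ω, ω²}`, when `ω` is quadratic over `O` and `O` has
no non-trivial cube root of unity. -/
theorem map_eq_one_of_pow_three_eq_one {O : Type*} [CommRing O] [IsDomain O] [CharZero O]
    (ι : O →+* C) {ω : C} (hω : 1 + ω + ω ^ 2 = 0)
    (hind : ∀ a b : O, ι a + ι b * ω = 0 → a = 0 ∧ b = 0)
    (hspan : ∀ x : C, ∃ a b : O, x = ι a + ι b * ω)
    (hcube : ∀ a : O, a ^ 3 = 1 → a = 1) (hR : (3 : R) = 0) (hφω : φ ω = 1)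
    {w : C} (hw : w ^ 3 = 1) : φ w = 1 := by
  obtain ⟨a, b, rfl⟩ := hspan w
  obtain ⟨h1, h2⟩ := hind (a ^ 3 + b ^ 3 - 3 * a * b ^ 2 - 1) (3 * a ^ 2 * b - 3 * a * b ^ 2) (by
    simp only [map_sub, map_add, map_mul, map_pow, map_one, map_ofNat]
    linear_combination hw - (3 * ι a * ι b ^ 2 + ι b ^ 3 * (ω - 1)) * hω)
  have h3 : (3 : O) * (a * (b * (a - b))) = 0 := by linear_combination h2
  simp only [mul_eq_zero, OfNat.ofNat_ne_zero, false_or, sub_eq_zero] at h3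
  -- The three cases are w = ω, w = 1 and w = -1 - ω = ω².
  rcases h3 with rfl | rfl | rfl
  · have := hcube b (by linear_combination h1)
    simp [this, hφω]
  · have := hcube a (by linear_combination h1)
    simp [this]
  · have := hcube (-a) (by linear_combination h1)
    have h4 : a = -1 := by linear_combination -this
    simp only [h4, map_add, map_mul, map_neg, map_one, hφω]
    linear_combination -hR

end Torsion
end SwanClass
-- Arithmetic of imaginary quadratic orders
namespace SwanClass

/-- An order containing `√-d` with index at most `2`, together with its conjugation. -/
structure ImaginaryQuadraticOrder (O : Type*) [CommRing O] (d : ℕ) where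
  root : O
  root_sq : root ^ 2 = -(d : O)
  pos : 0 < d
  exists_two_mul : ∀ x : O, ∃ m n : ℤ, 2 * x = m + n * root
  star : O →+* O
  star_root : star root = -root

namespace ImaginaryQuadraticOrder
variable {O : Type*} [CommRing O] {d : ℕ} (Q : ImaginaryQuadraticOrder O d)

theorem exists_eq_add_mul {p : ℕ} (hp : Odd p) (x : O) :
    ∃ (a b : ℤ) (y : O), 0 ≤ a ∧ a < p ∧ 0 ≤ b ∧ b < p ∧ x = a + b * Q.root + p * y := by
  obtain ⟨m, n, h⟩ := Q.exists_two_mul x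
  obtain ⟨k, rfl⟩ := hp
  have hpos : (0 : ℤ) < (2 * k + 1 : ℕ) := by positivity
  have h1 := congrArg (Int.cast (R := O)) (Int.emod_def (-(k * m)) ((2 * k + 1 : ℕ) : ℤ))
  have h2 := congrArg (Int.cast (R := O)) (Int.emod_def (-(k * n)) ((2 * k + 1 : ℕ) : ℤ))
  -- With p = 2k + 1, the integer -k is an inverse of 2 modulo p.
  refine ⟨-(k * m) % (2 * k + 1 : ℕ), -(k * n) % (2 * k + 1 : ℕ),
    x + (-(k * m) / (2 * k + 1 : ℕ) : ℤ) + (-(k * n) / (2 * k + 1 : ℕ) : ℤ) * Q.root,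
    Int.emod_nonneg _ hpos.ne', Int.emod_lt_of_pos _ hpos, Int.emod_nonneg _ hpos.ne',
    Int.emod_lt_of_pos _ hpos, ?_⟩
  rw [h1, h2]
  push_cast
  linear_combination (-(k : O)) * h

theorem mul_star_eq {x : O} {m n : ℤ} (h : 2 * x = m + n * Q.root) :
    4 * (x * Q.star x) = ((m ^ 2 + d * n ^ 2 : ℤ) : O) := by
  have h' := congrArg Q.star h
  simp only [map_mul, map_ofNat, map_add, map_intCast, Q.star_root] at h'
  push_cast
  linear_combination 2 * Q.star x * h + (m + n * Q.root) * h' - n ^ 2 * Q.root_sq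

variable [CharZero O]

theorem eq_zero_of_add_eq_zero {m n : ℤ} (h : (m : O) + n * Q.root = 0) : m = 0 ∧ n = 0 := by
  have h1 : ((m ^ 2 + d * n ^ 2 : ℤ) : O) = 0 := by
    push_cast
    linear_combination (m - n * Q.root) * h + n ^ 2 * Q.root_sq
  have h2 : m ^ 2 + d * n ^ 2 = 0 := by exact_mod_cast h1
  have hd : (0 : ℤ) < d := by exact_mod_cast Q.pos
  have hn : n = 0 := by
    by_contra hn
    have := mul_pos hd (pow_pos (abs_pos.2 hn) 2)
    rw [sq_abs] at this
    nlinarith [sq_nonneg m]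
  subst hn
  exact ⟨by simpa using h2, rfl⟩

theorem eq_of_add_eq_add {m n m' n' : ℤ} (h : (m : O) + n * Q.root = m' + n' * Q.root) :
    m = m' ∧ n = n' := by
  have := Q.eq_zero_of_add_eq_zero (m := m - m') (n := n - n') (by
    push_cast
    linear_combination h)
  omega

theorem dvd_of_dvd_add {p : ℕ} (hp : p.Prime) (hp2 : 2 < p) {m n : ℤ}
    (h : (p : O) ∣ m + n * Q.root) : (p : ℤ) ∣ m ∧ (p : ℤ) ∣ n := by
  obtain ⟨x, hx⟩ := h
  obtain ⟨a, b, hab⟩ := Q.exists_two_mul x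
  obtain ⟨h1, h2⟩ := Q.eq_of_add_eq_add (m := 2 * m) (n := 2 * n) (m' := p * a) (n' := p * b) (by
    push_cast
    linear_combination 2 * hx + p * hab)
  have hp' : Prime (p : ℤ) := Nat.prime_iff_prime_int.1 hp
  have h3 : ¬ (p : ℤ) ∣ 2 := fun h ↦ by
    have := Int.le_of_dvd (by norm_num) h
    omega
  exact ⟨(hp'.dvd_or_dvd (Dvd.intro _ h1.symm)).resolve_left h3,
    (hp'.dvd_or_dvd (Dvd.intro _ h2.symm)).resolve_left h3⟩

variable [IsDomain O]

theorem star_star (x : O) : Q.star (Q.star x) = x := by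
  obtain ⟨m, n, h⟩ := Q.exists_two_mul x
  have h' := congrArg (fun y ↦ Q.star (Q.star y)) h
  simp only [map_mul, map_ofNat, map_add, map_intCast, Q.star_root, map_neg, neg_neg] at h'
  exact mul_left_cancel₀ two_ne_zero (h'.trans h.symm)

theorem finite_bounded (B : ℤ) :
    {x : O | ∃ m n : ℤ, 2 * x = m + n * Q.root ∧ |m| ≤ B ∧ |n| ≤ B}.Finite := by
  have h := ((Set.finite_Icc (-B) B).prod (Set.finite_Icc (-B) B)).image
    fun v : ℤ × ℤ ↦ (v.1 : O) + v.2 * Q.root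
  refine (h.preimage (f := fun x : O ↦ 2 * x)
    (fun x _ y _ hxy ↦ mul_left_cancel₀ two_ne_zero hxy)).subset ?_
  rintro x ⟨m, n, hx, hm, hn⟩
  exact ⟨(m, n), ⟨abs_le.1 hm, abs_le.1 hn⟩, hx.symm⟩

theorem eq_one_of_pow_three (Q : ImaginaryQuadraticOrder O d) (hd3 : d ≠ 3) {x : O} (hx : x ^ 3 = 1) : x = 1 := by
  by_contra hne
  have h1 : x ^ 2 + x + 1 = 0 :=
    (mul_eq_zero.1 (by linear_combination hx : (x - 1) * (x ^ 2 + x + 1) = 0)).resolve_left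
      (sub_ne_zero.2 hne)
  obtain ⟨m, n, h⟩ := Q.exists_two_mul x
  -- These are the two components of (2x + 1)² = -3. They leave dn² = 3, hence d = 3.
  obtain ⟨h2, h3⟩ := Q.eq_of_add_eq_add (m := (m + 1) ^ 2 - d * n ^ 2) (n := 2 * (m + 1) * n)
    (m' := -3) (n' := 0) (by
      push_cast
      linear_combination 4 * h1 - (2 * x + m + n * Q.root + 2) * h - n ^ 2 * Q.root_sq)
  have hd : (0 : ℤ) < d := by exact_mod_cast Q.pos
  rcases mul_eq_zero.1 h3 with h4 | rfl
  · have hm : m + 1 = 0 := by omega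
    rw [hm] at h2
    have h5 : (d : ℤ) * n ^ 2 = 3 := by linarith
    have h6 : n ^ 2 ≤ 3 := by nlinarith [sq_nonneg n]
    have h7 : |n| < 2 := by
      refine abs_lt_of_sq_lt_sq (by linarith) (by norm_num)
    have h8 := abs_lt.1 h7
    have : n = -1 ∨ n = 0 ∨ n = 1 := by omega
    rcases this with rfl | rfl | rfl
    · exact hd3 (by exact_mod_cast (by linarith : (d : ℤ) = 3))
    · norm_num at h5
    · exact hd3 (by exact_mod_cast (by linarith : (d : ℤ) = 3))
  · nlinarith [sq_nonneg (m + 1)]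

end ImaginaryQuadraticOrder

/-! ### The ring O[G]/(Σ) -/

section QuotientRing
variable {O G : Type*} [CommRing O] [CommGroup G] [Fintype G]

/-- The quotient of the group ring by the ideal generated by `Σ`. -/
abbrev SumQuotient (O G : Type*) [CommRing O] [CommGroup G] [Fintype G] : Type _ :=
  MonoidAlgebra O G ⧸ Ideal.span {groupSum O G}

/-- The projection `O[G] → O[G]/(Σ)`. -/
noncomputable abbrev toSumQuotient (O G : Type*) [CommRing O] [CommGroup G] [Fintype G] :
    MonoidAlgebra O G →+* SumQuotient O G :=
  Ideal.Quotient.mk _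

theorem toSumQuotient_eq_zero {x : MonoidAlgebra O G} :
    toSumQuotient O G x = 0 ↔ ∃ c : O, x = algebraMap O _ c * groupSum O G :=
  Ideal.Quotient.eq_zero_iff_mem.trans mem_span_groupSum

/-- The augmentation `O[G]/(Σ) → O/|G|`. -/
noncomputable def augMod (O G : Type*) [CommRing O] [CommGroup G] [Fintype G] :
    SumQuotient O G →+* O ⧸ Ideal.span {(Fintype.card G : O)} :=
  Ideal.Quotient.lift _ ((Ideal.Quotient.mk _).comp (aug O G : MonoidAlgebra O G →+* O)) (by
    intro x hx
    obtain ⟨c, rfl⟩ := mem_span_groupSum.1 hx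
    rw [RingHom.comp_apply, Ideal.Quotient.eq_zero_iff_mem]
    refine Ideal.mem_span_singleton.2 ⟨c, ?_⟩
    simp only [RingHom.coe_coe, map_mul, aug_algebraMap, aug_groupSum]
    ring)

theorem augMod_toSumQuotient (x : MonoidAlgebra O G) :
    augMod O G (toSumQuotient O G x) = Ideal.Quotient.mk _ (aug O G x) := rfl

theorem sumQuotient_eq_zero_of_mul [IsDomain O] {c : O} (hc : c ≠ 0) {x : SumQuotient O G}
    (hx : toSumQuotient O G (algebraMap O _ c) * x = 0) : x = 0 := by
  obtain ⟨x, rfl⟩ := Ideal.Quotient.mk_surjective x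
  rw [← map_mul, toSumQuotient_eq_zero] at hx
  obtain ⟨a, ha⟩ := hx
  exact toSumQuotient_eq_zero.2 (exists_eq_of_algebraMap_mul_eq hc ha)

/-- The differences of coefficients x_g - x_1 are unchanged by adding multiples of Σ, so every power
of c divides them in O; in a Noetherian domain they vanish. -/
theorem sumQuotient_eq_zero_of_forall_pow_dvd [IsDomain O] [IsNoetherianRing O] {c : O}
    (hu : ¬ IsUnit c) {x : SumQuotient O G}
    (hx : ∀ n : ℕ, toSumQuotient O G (algebraMap O _ c) ^ n ∣ x) : x = 0 := by
  obtain ⟨x, rfl⟩ := Ideal.Quotient.mk_surjective x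
  refine toSumQuotient_eq_zero.2 ⟨x.coeff 1, ?_⟩
  ext g
  rw [coeff_algebraMap_mul_groupSum, ← sub_eq_zero]
  by_contra hne
  obtain ⟨n, hn⟩ := FiniteMultiplicity.of_not_isUnit hu hne
  refine hn ?_
  obtain ⟨y, hy⟩ := hx (n + 1)
  obtain ⟨y, rfl⟩ := Ideal.Quotient.mk_surjective y
  rw [← map_pow, ← map_mul, ← sub_eq_zero, ← map_sub, ← map_pow] at hy
  obtain ⟨k, hk⟩ := toSumQuotient_eq_zero.1 hy
  have hk' := sub_eq_iff_eq_add.1 hk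
  refine ⟨y.coeff g - y.coeff 1, ?_⟩
  rw [hk']
  simp only [MonoidAlgebra.coeff_add, Finsupp.add_apply, coeff_algebraMap_mul, coeff_groupSum]
  ring

/-- If (g - 1)x = cΣ, the augmentation gives 0 = c|G|, so c = 0; then x is G-invariant, hence a
multiple of Σ. -/
theorem sumQuotient_eq_zero_of_sub_one_mul [IsDomain O] [CharZero O] {g : G}
    (hg : ∀ h : G, h ∈ Subgroup.zpowers g) {x : SumQuotient O G}
    (hx : toSumQuotient O G (MonoidAlgebra.of O G g - 1) * x = 0) : x = 0 := by
  obtain ⟨x, rfl⟩ := Ideal.Quotient.mk_surjective x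
  rw [← map_mul, toSumQuotient_eq_zero] at hx
  obtain ⟨c, hc⟩ := hx
  have h1 := congrArg (aug O G) hc
  rw [map_mul, map_sub, aug_of, map_one, sub_self, zero_mul, map_mul, aug_algebraMap,
    aug_groupSum] at h1
  have h2 : c = 0 := (mul_eq_zero.1 h1.symm).resolve_right
    (Nat.cast_ne_zero.2 Fintype.card_ne_zero)
  rw [h2, map_zero, zero_mul] at hc
  exact toSumQuotient_eq_zero.2 (exists_eq_algebraMap_mul_groupSum_of_sub_one_mul hg hc)

theorem sub_one_dvd_of_augMod_eq_zero {g : G} (hg : ∀ h : G, h ∈ Subgroup.zpowers g)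
    {x : SumQuotient O G} (hx : augMod O G x = 0) :
    toSumQuotient O G (MonoidAlgebra.of O G g - 1) ∣ x := by
  obtain ⟨x, rfl⟩ := Ideal.Quotient.mk_surjective x
  obtain ⟨o, ho⟩ := Ideal.mem_span_singleton.1 (Ideal.Quotient.eq_zero_iff_mem.1 hx)
  have h1 := sub_one_dvd_of_aug_eq_zero hg
    (x := x - algebraMap O _ o * groupSum O G) (by
      rw [map_sub, map_mul, aug_algebraMap, aug_groupSum, sub_eq_zero, mul_comm]
      exact ho)
  have h2 := map_dvd (toSumQuotient O G) h1
  rwa [map_sub (toSumQuotient O G) x, toSumQuotient_eq_zero.2 ⟨o, rfl⟩, sub_zero] at h2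

/-- Elements of relative absolute value one in `O[G]/(Σ)` have finite order. -/
theorem exists_pow_eq_one_of_mul_conj [IsDomain O] [CharZero O] {d : ℕ}
    (Q : ImaginaryQuadraticOrder O d) (hG : Odd (Fintype.card G)) {x : MonoidAlgebra O G}
    (hx : toSumQuotient O G (x * conj G Q.star x) = 1) :
    ∃ n : ℕ, 0 < n ∧ toSumQuotient O G x ^ n = 1 := by
  set p := Fintype.card G with hp
  let B : ℤ := 4 * p + 4 * (p ^ 2 + d * p ^ 2)
  let F := {x : O | ∃ m n : ℤ, 2 * x = m + n * Q.root ∧ |m| ≤ B ∧ |n| ≤ B}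
  have hF : {X : MonoidAlgebra O G | ∀ g, X.coeff g ∈ F}.Finite := by
    have h := Set.Finite.pi' (ι := G) (fun _ ↦ Q.finite_bounded B)
    refine (h.preimage (f := fun X : MonoidAlgebra O G ↦ fun g ↦ X.coeff g) ?_).subset
      fun X hX ↦ hX
    intro X _ Y _ hXY
    ext g
    exact congrFun hXY g
  have hT : {w : SumQuotient O G | ∃ y, toSumQuotient O G y = w ∧
      toSumQuotient O G (y * conj G Q.star y) = 1}.Finite := by
    refine (hF.image (toSumQuotient O G)).subset ?_
    rintro _ ⟨y, rfl, hy⟩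
    -- Subtracting oΣ changes the augmentation by po, so each class has a representative with
    -- augmentation a + b√-d and 0 ≤ a, b < p.
    obtain ⟨a, b, o, ha0, ha, hb0, hb, hab⟩ := Q.exists_eq_add_mul hG (aug O G y)
    set X := y - algebraMap O _ o * groupSum O G with hX
    have hmk : toSumQuotient O G X = toSumQuotient O G y := by
      rw [hX, map_sub, toSumQuotient_eq_zero.2 ⟨o, rfl⟩, sub_zero]
    refine ⟨X, fun g ↦ ?_, hmk⟩
    have haX : aug O G X = a + b * Q.root := by
      rw [hX, map_sub, map_mul, aug_algebraMap, aug_groupSum, hab, ← hp]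
      ring
    obtain ⟨k, hk⟩ : ∃ k, X * conj G Q.star X - 1 = algebraMap O _ k * groupSum O G := by
      have hcX : conj G Q.star X = conj G Q.star y -
          algebraMap O _ (Q.star o) * groupSum O G := by
        rw [hX, map_sub, map_mul, conj_algebraMap, conj_groupSum]
      refine toSumQuotient_eq_zero.1 ?_
      rw [map_sub, map_mul, map_one, hmk, hcX, map_sub, toSumQuotient_eq_zero.2 ⟨_, rfl⟩,
        sub_zero, ← map_mul, hy, sub_self]
    have hk' := sub_eq_iff_eq_add.1 hk
    have h1 := congrArg (aug O G) hk'
    have h2 := congrArg (fun Z : MonoidAlgebra O G ↦ Z.coeff 1) hk'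
    simp only [map_add, map_mul, aug_conj, haX, aug_algebraMap, aug_groupSum, map_one,
      map_intCast, Q.star_root, ← hp] at h1
    simp only [coeff_one_mul_conj, MonoidAlgebra.coeff_add, Finsupp.add_apply,
      coeff_algebraMap_mul_groupSum, MonoidAlgebra.coeff_one_one] at h2
    choose m n hmn using fun g ↦ Q.exists_two_mul (X.coeff g)
    -- In X X̄ = 1 + kΣ the augmentation gives a² + db² = 1 + kp, and the coefficient at 1 gives 1 +
    -- k as the sum of the norms of the coefficients. Eliminating k bounds that sum, which is the
    -- origin of `B`.
    have h3 : (p : ℤ) * ∑ g, (m g ^ 2 + d * n g ^ 2) = 4 * p + 4 * (a ^ 2 + d * b ^ 2) - 4 := by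
      have h4 : ((∑ g, (m g ^ 2 + d * n g ^ 2) : ℤ) : O) = 4 * (k + 1) := by
        rw [← h2, Finset.mul_sum, Int.cast_sum]
        exact Finset.sum_congr rfl fun g _ ↦ (Q.mul_star_eq (hmn g)).symm
      have h5 : (((p : ℤ) * ∑ g, (m g ^ 2 + d * n g ^ 2) : ℤ) : O) =
          ((4 * p + 4 * (a ^ 2 + d * b ^ 2) - 4 : ℤ) : O) := by
        rw [Int.cast_mul, h4]
        push_cast
        linear_combination (-4 : O) * h1 - 4 * b ^ 2 * Q.root_sq
      exact_mod_cast h5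
    have hp1 : (1 : ℤ) ≤ p := by exact_mod_cast Fintype.card_pos (α := G)
    have hd : (1 : ℤ) ≤ d := by exact_mod_cast Q.pos
    have h4 : m g ^ 2 + d * n g ^ 2 ≤ ∑ g, (m g ^ 2 + d * n g ^ 2) :=
      Finset.single_le_sum (f := fun g ↦ m g ^ 2 + (d : ℤ) * n g ^ 2)
        (fun g _ ↦ by positivity) (Finset.mem_univ g)
    have h5 : ∑ g, (m g ^ 2 + d * n g ^ 2) ≤ B := by
      have h0 : 0 ≤ ∑ g, (m g ^ 2 + d * n g ^ 2) :=
        Finset.sum_nonneg fun g _ ↦ by positivity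
      have ha2 : a ^ 2 ≤ p ^ 2 := pow_le_pow_left₀ ha0 ha.le 2
      have hb2 : b ^ 2 ≤ p ^ 2 := pow_le_pow_left₀ hb0 hb.le 2
      have := mul_le_mul_of_nonneg_left hb2 (by linarith : (0 : ℤ) ≤ d)
      have := mul_le_mul_of_nonneg_right hp1 h0
      simp only [B]
      linarith
    have h6 (z : ℤ) : |z| ≤ z ^ 2 := by
      rw [← sq_abs]
      exact Int.le_self_sq _
    refine ⟨m g, n g, hmn g, ?_, ?_⟩
    · have := mul_nonneg (by linarith : (0 : ℤ) ≤ d) (sq_nonneg (n g))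
      linarith [h6 (m g)]
    · have := mul_le_mul_of_nonneg_right hd (sq_nonneg (n g))
      linarith [h6 (n g), sq_nonneg (m g)]
  have hpow (n : ℕ) : toSumQuotient O G x ^ n ∈ {w : SumQuotient O G |
      ∃ y, toSumQuotient O G y = w ∧ toSumQuotient O G (y * conj G Q.star y) = 1} :=
    ⟨x ^ n, map_pow _ _ _, by rw [map_pow, ← mul_pow, map_pow, hx, one_pow]⟩
  obtain ⟨i, j, hij, h⟩ := Set.Finite.exists_lt_map_eq_of_forall_mem hpow hT
  refine ⟨j - i, Nat.sub_pos_of_lt hij, ?_⟩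
  have hu : IsUnit (toSumQuotient O G x ^ i) := by
    rw [map_mul] at hx
    exact (IsUnit.of_mul_eq_one _ hx).pow i
  refine hu.mul_left_cancel ?_
  rw [← pow_add, Nat.add_sub_of_le hij.le, mul_one]
  exact h.symm

end QuotientRing
end SwanClass
namespace SwanClass

/-! ### 1 + √-d is not the augmentation of a unit modulo Σ -/

section Units
variable {O G : Type*} [CommRing O] [IsDomain O] [CharZero O] [CommGroup G] [Fintype G] {d p : ℕ}

theorem map_eq_one_of_card_eq_three (Q : ImaginaryQuadraticOrder O d) (hd3 : d ≠ 3)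
    (hG : Fintype.card G = 3) {g : G} (hg : ∀ h : G, h ∈ Subgroup.zpowers g)
    {w : SumQuotient O G} (hw : w ^ 3 = 1) : augMod O G w = 1 := by
  set ω := toSumQuotient O G (MonoidAlgebra.of O G g) with hωdef
  have ho : orderOf g = 3 := by
    rw [orderOf_eq_card_of_forall_mem_zpowers hg, Nat.card_eq_fintype_card, hG]
  have hω3 : ω ^ 3 = 1 := by
    rw [hωdef, ← map_pow, ← map_pow, ← ho, pow_orderOf_eq_one, map_one, map_one]
  have hω : 1 + ω + ω ^ 2 = 0 := by
    refine sumQuotient_eq_zero_of_sub_one_mul hg ?_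
    rw [map_sub, map_one]
    linear_combination hω3
  let ι : O →+* SumQuotient O G := (toSumQuotient O G).comp (algebraMap O _)
  refine map_eq_one_of_pow_three_eq_one (augMod O G) ι hω ?_ ?_
    (fun a ha ↦ Q.eq_one_of_pow_three hd3 ha) ?_ ?_ hw
  · intro a b hab
    have h1 : toSumQuotient O G (algebraMap O _ a * MonoidAlgebra.of O G 1 +
        algebraMap O _ b * MonoidAlgebra.of O G g) = 0 := by
      rw [map_add, map_mul, map_mul, map_one, map_one, mul_one]
      exact hab
    obtain ⟨c, hc⟩ := toSumQuotient_eq_zero.1 h1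
    have h2 (k : G) := congrArg (fun Z : MonoidAlgebra O G ↦ Z.coeff k) hc
    simp only [MonoidAlgebra.coeff_add, Finsupp.add_apply, coeff_algebraMap_mul,
      MonoidAlgebra.of_apply, MonoidAlgebra.coeff_single, coeff_groupSum, mul_one] at h2
    have hg1 : g ≠ 1 := by
      rintro rfl
      rw [orderOf_one] at ho
      omega
    have hg2 : g ^ 2 ≠ 1 := by
      intro h
      have := orderOf_dvd_of_pow_eq_one h
      rw [ho] at this
      omega
    have hg3 : g ^ 2 ≠ g := by
      rw [pow_two]
      simpa using hg1
    have e0 := h2 (g ^ 2)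
    have e1 := h2 1
    have e2 := h2 g
    rw [Finsupp.single_eq_of_ne hg2, Finsupp.single_eq_of_ne hg3] at e0
    rw [Finsupp.single_eq_same, Finsupp.single_eq_of_ne hg1.symm] at e1
    rw [Finsupp.single_eq_same, Finsupp.single_eq_of_ne hg1] at e2
    exact ⟨by linear_combination e1 - e0, by linear_combination e2 - e0⟩
  · have hpow (n : ℕ) : ∃ a b : O, ω ^ n = ι a + ι b * ω := by
      induction n with
      | zero => exact ⟨1, 0, by simp⟩
      | succ n ih =>
        obtain ⟨a, b, h⟩ := ih
        refine ⟨-b, a - b, ?_⟩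
        rw [pow_succ, h, map_neg, map_sub]
        linear_combination ι b * hω
    intro x
    obtain ⟨x, rfl⟩ := Ideal.Quotient.mk_surjective x
    change ∃ a b, toSumQuotient O G x = _
    rw [← sum_algebraMap_mul_of x, map_sum]
    refine Finset.sum_induction _ (fun y ↦ ∃ a b : O, y = ι a + ι b * ω) ?_ ⟨0, 0, by simp⟩ ?_
    · rintro _ _ ⟨a, b, rfl⟩ ⟨a', b', rfl⟩
      exact ⟨a + a', b + b', by rw [map_add, map_add]; ring⟩
    · intro h _
      obtain ⟨n, rfl⟩ := (mem_powers_iff_mem_zpowers (x := g)).2 (hg h)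
      obtain ⟨a, b, hab⟩ := hpow n
      refine ⟨x.coeff (g ^ n) * a, x.coeff (g ^ n) * b, ?_⟩
      have h1 : toSumQuotient O G (MonoidAlgebra.of O G (g ^ n)) = ι a + ι b * ω := by
        rw [map_pow, map_pow, hab]
      change toSumQuotient O G (_ * MonoidAlgebra.of O G (g ^ n)) = _
      rw [map_mul, h1, map_mul, map_mul]
      change ι _ * _ = _
      ring
  · rw [← map_ofNat (Ideal.Quotient.mk _) 3, Ideal.Quotient.eq_zero_iff_mem, hG]
    exact Ideal.mem_span_singleton_self _
  · rw [hωdef, augMod_toSumQuotient, aug_of, map_one]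

theorem not_exists_unit_of_aug_eq_one_add_root [IsNoetherianRing O]
    (Q : ImaginaryQuadraticOrder O d) (hd3 : d ≠ 3) (hp : p.Prime) (hp2 : 2 < p) (hpd : p ∣ d)
    [IsCyclic G] (hG : Fintype.card G = p) :
    ¬ ∃ (u v : MonoidAlgebra O G) (c : O), u * v = 1 + algebraMap O _ c * groupSum O G ∧
      aug O G u = 1 + Q.root := by
  rintro ⟨u, v, c, huv, hu⟩
  obtain ⟨g, hg⟩ := IsCyclic.exists_generator (α := G)
  have hodd : Odd p := hp.odd_of_ne_two (by omega)
  set mk := toSumQuotient O G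
  set φ := augMod O G
  set ε := mk (algebraMap O _ Q.root) with hεdef
  set π := mk (MonoidAlgebra.of O G g - 1) with hπdef
  have hpO : ((p : ℕ) : O) ≠ 0 := Nat.cast_ne_zero.2 hp.ne_zero
  have hmkp : mk (algebraMap O _ (p : O)) = p := by simp
  have hpu : ¬ IsUnit (p : O) := by
    intro h
    have h1 := (Q.dvd_of_dvd_add hp hp2 (m := 1) (n := 0) h.dvd).1
    have := Int.le_of_dvd one_pos h1
    omega
  have hpR : ((p : ℕ) : O ⧸ Ideal.span {(Fintype.card G : O)}) = 0 := by
    rw [← map_natCast (Ideal.Quotient.mk _) p, Ideal.Quotient.eq_zero_iff_mem, hG]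
    exact Ideal.mem_span_singleton_self _
  have htf (x : SumQuotient O G) (hx : (p : SumQuotient O G) * x = 0) : x = 0 :=
    sumQuotient_eq_zero_of_mul hpO (hmkp ▸ hx)
  have hsep (x : SumQuotient O G) (hx : ∀ n : ℕ, (p : SumQuotient O G) ^ n ∣ x) : x = 0 :=
    sumQuotient_eq_zero_of_forall_pow_dvd hpu (fun n ↦ hmkp ▸ hx n)
  have hφε : φ ε = Ideal.Quotient.mk _ Q.root := by
    rw [hεdef, augMod_toSumQuotient, aug_algebraMap]
  have hφπ : φ π = 0 := by
    rw [hπdef, augMod_toSumQuotient, map_sub, aug_of, map_one, sub_self, map_zero]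
  have hker (x) (hx : φ x = 0) : π ∣ x := sub_one_dvd_of_augMod_eq_zero hg hx
  have hrep (x : SumQuotient O G) : ∃ a b : ℤ, φ x = a + b * φ ε := by
    obtain ⟨x, rfl⟩ := Ideal.Quotient.mk_surjective x
    obtain ⟨a, b, y, -, -, -, -, h⟩ := Q.exists_eq_add_mul hodd (aug O G x)
    refine ⟨a, b, ?_⟩
    change Ideal.Quotient.mk _ (aug O G x) = _
    rw [h, hφε]
    simp only [map_add, map_mul, map_intCast, map_natCast, hpR, zero_mul, add_zero]
  have hε : (p : SumQuotient O G) ∣ ε ^ 2 := by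
    obtain ⟨e, he⟩ := hpd
    refine ⟨-e, ?_⟩
    rw [hεdef, ← map_pow, ← map_pow, Q.root_sq, he]
    simp only [map_neg, map_mul, map_natCast, Nat.cast_mul]
    ring
  have hφε2 : φ ε * φ ε = 0 := by
    obtain ⟨s, hs⟩ := hε
    rw [← map_mul, ← pow_two, hs, map_mul, map_natCast, hpR, zero_mul]
  have hζ : (1 + π) ^ p = 1 := by
    rw [hπdef, map_sub, map_one, add_sub_cancel, ← map_pow, ← map_pow, ← hG, pow_card_eq_one,
      map_one, map_one]
  have hπ : ∃ t, π ^ (p - 1) = -(p * (1 + π * t)) := by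
    obtain ⟨t, ht⟩ := exists_one_add_pow_prime_eq hp π
    refine ⟨t, ?_⟩
    rw [hζ] at ht
    rw [← sub_eq_zero]
    -- (1 + π)^p = 1 reads π^p + pπ(1 + πt) = 0, from which the non-zero-divisor π is cancelled.
    refine sumQuotient_eq_zero_of_sub_one_mul hg ?_
    change π * _ = 0
    have h1 : π ^ p = π * π ^ (p - 1) := by
      rw [← pow_succ', Nat.sub_add_cancel hp.one_le]
    linear_combination -ht - h1
  have hmkuv : mk (u * v) = 1 := by
    rw [huv, map_add, map_one, toSumQuotient_eq_zero.2 ⟨c, rfl⟩, add_zero]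
  have hconj : mk (conj G Q.star (u * v)) = 1 := by
    rw [huv, map_add, map_one, map_mul, conj_algebraMap, conj_groupSum, map_add, map_one,
      toSumQuotient_eq_zero.2 ⟨_, rfl⟩, add_zero]
  have hcc (x : MonoidAlgebra O G) : conj G Q.star (conj G Q.star x) = x := by
    conv_rhs => rw [← sum_algebraMap_mul_of x]
    conv_lhs => rw [← sum_algebraMap_mul_of x]
    simp only [map_sum, map_mul, conj_algebraMap, conj_of, Q.star_star, inv_inv]
  -- Modulo Σ, v is the inverse of u, so this element is u/ū, of relative absolute value one.
  obtain ⟨N, hN, hwN⟩ := exists_pow_eq_one_of_mul_conj Q (x := u * conj G Q.star v) (hG ▸ hodd) (by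
    have : u * conj G Q.star v * conj G Q.star (u * conj G Q.star v) =
        (u * v) * conj G Q.star (u * v) := by
      rw [map_mul, map_mul, hcc]
      ring
    rw [this, map_mul, hmkuv, hconj, mul_one])
  set w := mk (u * conj G Q.star v) with hwdef
  have hφw : φ w = 1 + 2 * φ ε := by
    have h1 : φ (mk (conj G Q.star (u * v))) = 1 := by rw [hconj, map_one]
    have h2 : φ (mk (conj G Q.star u)) = 1 - φ ε := by
      rw [augMod_toSumQuotient, aug_conj, hu, map_add, map_one, Q.star_root, map_add, map_one,
        map_neg, hφε, sub_eq_add_neg]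
    have h3 : φ (mk u) = 1 + φ ε := by
      rw [augMod_toSumQuotient, hu, map_add, map_one, hφε]
    rw [map_mul (conj G Q.star), map_mul, map_mul, h2] at h1
    rw [hwdef, map_mul, map_mul, h3]
    linear_combination (1 + φ ε) ^ 2 * h1 +
      (φ (mk (conj G Q.star v)) * (1 + φ ε) + 1) * hφε2
  -- Raising to the prime-to-p part M of the order leaves an element of p-power order without losing
  -- the ε-component 2M, which is nonzero modulo p.
  obtain ⟨k, M, hM, rfl⟩ := Nat.exists_eq_pow_mul_and_not_dvd hN.ne' p hp.ne_one
  have hφwM (n : ℕ) : φ (w ^ n) = 1 + (2 * n : ℤ) * φ ε := by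
    induction n with
    | zero => simp
    | succ n ih =>
      rw [pow_succ, map_mul, ih, hφw]
      push_cast
      linear_combination 4 * n * hφε2
  have hwM : (w ^ M) ^ p ^ k = 1 := by rw [← pow_mul, mul_comm, hwN]
  have hπp : (p : SumQuotient O G) ∣ π ^ (p - 1) := by
    obtain ⟨t, ht⟩ := hπ
    exact ⟨-(1 + π * t), by rw [ht]; ring⟩
  have hwp := pow_prime_eq_one_of_map_eq φ hp hp2 htf hsep hker hε hπp hwM (hφwM M)
  have hone : φ (w ^ M) = 1 := by
    rcases eq_or_ne p 3 with rfl | hp3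
    · exact map_eq_one_of_card_eq_three Q hd3 hG hg hwp
    · have hp4 : p ≠ 4 := by rintro rfl; exact absurd hp (by norm_num)
      exact map_eq_one_of_pow_prime_eq_one φ hp (by omega) htf hpR hφπ hker hrep hε hπ hζ hwp
        (hφwM M)
  rw [hφwM, add_eq_left, hφε, ← map_intCast (Ideal.Quotient.mk (Ideal.span {(Fintype.card G : O)})), ← map_mul,
    Ideal.Quotient.eq_zero_iff_mem, Ideal.mem_span_singleton, hG] at hone
  have h1 := (Q.dvd_of_dvd_add hp hp2 (m := 0) (n := 2 * M) (by simpa using hone)).2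
  have h2 : p ∣ 2 * M := by exact_mod_cast h1
  rcases hp.dvd_mul.1 h2 with h3 | h3
  · have := Nat.le_of_dvd two_pos h3
    omega
  · exact hM h3

end Units
end SwanClass
namespace SwanClass

/-! ### The ring of integers of ℚ(√-d) -/

section RingOfIntegers
open NumberField Polynomial

theorem exists_intCast_eq_of_squarefree {d : ℕ} (hsq : Squarefree d) {q : ℚ} {z : ℤ}
    (h : d * q ^ 2 = z) : ∃ m : ℤ, q = m := by
  have h1 : IsIntegral ℤ ((d : ℚ) * q) := by
    refine IsIntegral.of_pow (n := 2) two_pos ?_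
    have : ((d : ℚ) * q) ^ 2 = algebraMap ℤ ℚ (d * z) := by
      simp only [eq_intCast, Int.cast_mul, Int.cast_natCast, ← h]
      ring
    rw [this]
    exact isIntegral_algebraMap
  obtain ⟨m, hm⟩ := IsIntegrallyClosed.isIntegral_iff.1 h1
  rw [eq_intCast] at hm
  have h2 : m ^ 2 = d * z := by
    have : (m : ℚ) ^ 2 = d * z := by rw [hm, ← h]; ring
    exact_mod_cast this
  have hsq' : Squarefree (d : ℤ) := Int.squarefree_natCast.2 hsq
  obtain ⟨k, hk⟩ := (hsq'.dvd_pow_iff_dvd two_ne_zero).1 (Dvd.intro _ h2.symm)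
  refine ⟨k, ?_⟩
  have hd : (d : ℚ) ≠ 0 := Nat.cast_ne_zero.2 hsq.ne_zero
  apply mul_left_cancel₀ hd
  rw [← hm, hk]
  push_cast
  rfl

variable {K : Type*} [Field K] [NumberField K] {d : ℕ} {α : K}

theorem exists_eq_add_mul_of_adjoin_eq_top (hα : α ^ 2 = -(d : K))
    (hK : IntermediateField.adjoin ℚ {α} = ⊤) (x : K) : ∃ r s : ℚ, x = r + s * α := by
  have hint : IsIntegral ℚ α := Algebra.IsIntegral.isIntegral α
  have hx : x ∈ Algebra.adjoin ℚ {α} := by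
    rw [← IntermediateField.adjoin_simple_toSubalgebra_of_isAlgebraic hint.isAlgebraic, hK]
    trivial
  induction hx using Algebra.adjoin_induction with
  | mem x hx =>
    rw [Set.mem_singleton_iff] at hx
    exact ⟨0, 1, by simp [hx]⟩
  | algebraMap r => exact ⟨r, 0, by simp⟩
  | add x y _ _ h1 h2 =>
    obtain ⟨a, b, rfl⟩ := h1
    obtain ⟨c, e, rfl⟩ := h2
    exact ⟨a + c, b + e, by push_cast; ring⟩
  | mul x y _ _ h1 h2 =>
    obtain ⟨a, b, rfl⟩ := h1
    obtain ⟨c, e, rfl⟩ := h2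
    exact ⟨a * c - d * (b * e), a * e + b * c, by
      push_cast
      linear_combination (b * e : K) * hα⟩

theorem exists_algHom_root_eq_neg (hd : 0 < d) (hα : α ^ 2 = -(d : K))
    (hK : IntermediateField.adjoin ℚ {α} = ⊤) : ∃ f : K →ₐ[ℚ] K, f α = -α := by
  have hint : IsIntegral ℚ α := Algebra.IsIntegral.isIntegral α
  have hadj : Algebra.adjoin ℚ {α} = ⊤ := by
    rw [← IntermediateField.adjoin_simple_toSubalgebra_of_isAlgebraic hint.isAlgebraic, hK]
    rfl
  have hirr : Irreducible (X ^ 2 - C (-(d : ℚ))) := by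
    refine X_pow_sub_C_irreducible_of_prime Nat.prime_two fun b hb ↦ ?_
    have : (0 : ℚ) < d := Nat.cast_pos.2 hd
    linarith [sq_nonneg b]
  have hmin : minpoly ℚ α = X ^ 2 - C (-(d : ℚ)) :=
    (minpoly.eq_of_irreducible_of_monic hirr (by simp [hα])
      (monic_X_pow_sub_C _ two_ne_zero)).symm
  let pb := PowerBasis.ofAdjoinEqTop hint hadj
  have hgen : pb.gen = α := PowerBasis.ofAdjoinEqTop_gen hint hadj
  have hroot : aeval (-α) (minpoly ℚ pb.gen) = 0 := by
    rw [hgen, hmin]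
    simp [hα]
  refine ⟨pb.lift (-α) hroot, ?_⟩
  exact (congrArg (pb.lift (-α) hroot) hgen.symm).trans (pb.lift_gen _ hroot)

/-- For integral x = r + sα, the trace 2r and the number -(x - x̄)² = d(2s)² are rational integers;
as d is squarefree, 2s is one too. -/
theorem nonempty_imaginaryQuadraticOrder (hd : 0 < d) (hsq : Squarefree d)
    (hα : α ^ 2 = -(d : K)) (hK : IntermediateField.adjoin ℚ {α} = ⊤) :
    Nonempty (ImaginaryQuadraticOrder (𝓞 K) d) := by
  obtain ⟨f, hf⟩ := exists_algHom_root_eq_neg hd hα hK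
  have hαint : IsIntegral ℤ α := by
    refine IsIntegral.of_pow (n := 2) two_pos ?_
    rw [hα]
    have := (isIntegral_algebraMap (R := ℤ) (A := K) (x := (d : ℤ))).neg
    rwa [eq_intCast, Int.cast_natCast] at this
  refine ⟨⟨⟨α, hαint⟩, ?_, hd, fun x ↦ ?_, RingOfIntegers.mapRingHom (f : K →+* K), ?_⟩⟩
  · apply RingOfIntegers.ext
    exact hα.trans (by simp)
  · obtain ⟨r, s, hx⟩ := exists_eq_add_mul_of_adjoin_eq_top hα hK (x : K)
    have hxi : IsIntegral ℤ (x : K) := x.2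
    have hfx : f (x : K) = r - s * α := by
      rw [hx, map_add, map_mul, hf, map_ratCast, map_ratCast]
      ring
    have hfi : IsIntegral ℤ (r - s * α : K) := hfx ▸ hxi.map f
    have key (q : ℚ) (h : IsIntegral ℤ (q : K)) : ∃ z : ℤ, q = z := by
      rw [← eq_ratCast (algebraMap ℚ K), isIntegral_algebraMap_iff (algebraMap ℚ K).injective] at h
      obtain ⟨z, hz⟩ := IsIntegrallyClosed.isIntegral_iff.1 h
      exact ⟨z, hz.symm⟩
    obtain ⟨m, hm⟩ := key (2 * r) (by
      have := hxi.add hfi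
      rw [hx] at this
      have e : ((2 * r : ℚ) : K) = r + s * α + (r - s * α) := by
        push_cast
        ring
      rwa [e])
    obtain ⟨z, hz⟩ := key (d * (2 * s) ^ 2) (by
      have := ((hxi.sub hfi).pow 2).neg
      rw [hx] at this
      have e : ((d * (2 * s) ^ 2 : ℚ) : K) = -(r + s * α - (r - s * α)) ^ 2 := by
        push_cast
        linear_combination (4 * (s : K) ^ 2) * hα
      rwa [e])
    obtain ⟨n, hn⟩ := exists_intCast_eq_of_squarefree hsq hz
    refine ⟨m, n, ?_⟩
    apply RingOfIntegers.ext
    have hm' := congrArg (Rat.cast (K := K)) hm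
    have hn' := congrArg (Rat.cast (K := K)) hn
    push_cast at hm' hn'
    change (2 : K) * (x : K) = (m : K) + (n : K) * α
    rw [hx]
    linear_combination hm' + α * hn'
  · apply RingOfIntegers.ext
    exact hf

end RingOfIntegers

/-! ### Classes of Swan modules -/

section Classes
open NumberField
variable {K G : Type*} [Field K] [NumberField K] [CommGroup G] [Fintype G]

theorem swanClass_add {r s : 𝓞 K} (hr0 : r ≠ 0) (hr : IsCoprime r (Fintype.card G : 𝓞 K))
    (hs : IsCoprime s (Fintype.card G : 𝓞 K)) :
    swanClass G r hr + swanClass G s hs = swanClass G (r * s) (hr.mul_left hs) := by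
  obtain ⟨a, b, hab⟩ := id hr
  obtain ⟨e⟩ := swanModule_prod_equiv (G := G) s hr0
    (q := a) (t := -b) (by linear_combination hab)
  rw [← zero_add (swanClass G (r * s) _)]
  exact (stableClass_eq_iff _ _).2 (.of_equiv e)

theorem swanClass_eq_zero_of_unit {r c : 𝓞 K} (hr0 : r ≠ 0)
    (hr : IsCoprime r (Fintype.card G : 𝓞 K)) {u v : MonoidAlgebra (𝓞 K) G}
    (huv : u * v = 1 + algebraMap (𝓞 K) _ c * groupSum (𝓞 K) G) (hu : aug (𝓞 K) G u = r) :
    swanClass G r hr = 0 := by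
  obtain ⟨e⟩ := swanModule_equiv_self hr0 huv hu
  exact (stableClass_eq_iff _ _).2 (.of_equiv e)

theorem exists_unit_of_swanClass_eq_zero {r : 𝓞 K} (hr0 : r ≠ 0)
    (hr : IsCoprime r (Fintype.card G : 𝓞 K)) (h : swanClass G r hr = 0) :
    ∃ (u v : MonoidAlgebra (𝓞 K) G) (c : 𝓞 K),
      u * v = 1 + algebraMap (𝓞 K) _ c * groupSum (𝓞 K) G ∧ aug (𝓞 K) G u = r :=
  exists_unit_of_swanModule_stablyIsomorphic hr0 ((stableClass_eq_iff _ _).1 h)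

theorem swanClass_eq_zero_of_eq_one_add {r t : 𝓞 K} (hr0 : r ≠ 0)
    (hr : IsCoprime r (Fintype.card G : 𝓞 K)) (h : r = 1 + Fintype.card G * t) :
    swanClass G r hr = 0 := by
  refine swanClass_eq_zero_of_unit (c := t) (v := 1) hr0 hr (mul_one _) ?_
  rw [map_add, map_one, map_mul, aug_algebraMap, aug_groupSum, h, mul_comm t]

/-- If a is inverse to s modulo |G|, then ra and sa are both ≡ 1, so adding the class of a makes
both sides zero. That |G| is not a unit ensures a ≠ 0. -/
theorem swanClass_eq_of_eq_add {r s t : 𝓞 K} (hr0 : r ≠ 0) (hs0 : s ≠ 0)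
    (hn : ¬ IsUnit (Fintype.card G : 𝓞 K))
    (hr : IsCoprime r (Fintype.card G : 𝓞 K)) (hs : IsCoprime s (Fintype.card G : 𝓞 K))
    (h : r = s + Fintype.card G * t) : swanClass G r hr = swanClass G s hs := by
  obtain ⟨a, b, hab⟩ := id hs
  have ha : IsCoprime a (Fintype.card G : 𝓞 K) := ⟨s, b, by linear_combination hab⟩
  have ha0 : a ≠ 0 := by
    rintro rfl
    exact hn (IsUnit.of_mul_eq_one b (by linear_combination hab))
  apply add_right_cancel (b := swanClass G a ha)
  rw [swanClass_add hr0, swanClass_add hs0,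
    swanClass_eq_zero_of_eq_one_add (t := a * t - b) (mul_ne_zero hr0 ha0) _
      (by rw [h]; linear_combination hab),
    swanClass_eq_zero_of_eq_one_add (t := -b) (mul_ne_zero hs0 ha0) _
      (by linear_combination hab)]

/-- For a generator x and al ≡ 1 modulo |G|, the quotient (x^a - 1)/(x - 1) has augmentation a and
inverse (x^(al) - 1)/(x^a - 1) modulo Σ, because x^(al) = x. -/
theorem swanClass_natCast_eq_zero [IsCyclic G] {a : ℕ} (ha0 : (a : 𝓞 K) ≠ 0)
    (hcard : 1 < Fintype.card G) (hc : a.Coprime (Fintype.card G))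
    (ha : IsCoprime (a : 𝓞 K) (Fintype.card G : 𝓞 K)) : swanClass G (a : 𝓞 K) ha = 0 := by
  obtain ⟨g, hg⟩ := IsCyclic.exists_generator (α := G)
  obtain ⟨l, -, hl⟩ := Nat.exists_mul_mod_eq_one_of_coprime hc hcard
  set x := MonoidAlgebra.of (𝓞 K) G g with hx
  have h1 : (x - 1) * ((∑ i ∈ Finset.range a, x ^ i) * (∑ i ∈ Finset.range l, (x ^ a) ^ i) - 1) =
      0 := by
    have e1 := geom_sum_mul x a
    have e2 := geom_sum_mul (x ^ a) l
    have e3 : (x ^ a) ^ l = x := by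
      rw [hx, ← pow_mul, ← map_pow, ← Nat.mod_add_div (a * l) (Fintype.card G), hl, pow_add,
        pow_mul, pow_card_eq_one, one_pow, mul_one, pow_one]
    rw [e3] at e2
    linear_combination (∑ i ∈ Finset.range l, (x ^ a) ^ i) * e1 + e2
  obtain ⟨c, hc⟩ := exists_eq_algebraMap_mul_groupSum_of_sub_one_mul hg h1
  refine swanClass_eq_zero_of_unit ha0 ha (c := c) (sub_eq_iff_eq_add'.1 hc) ?_
  simp only [map_sum, map_pow, hx, aug_of, one_pow, Finset.sum_const, Finset.card_range,
    nsmul_eq_mul, mul_one]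

theorem swanClass_pow {r : 𝓞 K} (hr0 : r ≠ 0) (hr : IsCoprime r (Fintype.card G : 𝓞 K)) (n : ℕ) :
    swanClass G (r ^ n) hr.pow_left = n • swanClass G r hr := by
  induction n with
  | zero =>
    rw [zero_smul]
    exact swanClass_eq_zero_of_eq_one_add (t := 0) (by simp) _ (by simp)
  | succ n ih =>
    rw [add_smul, one_smul, ← ih, swanClass_add (pow_ne_zero _ hr0)]
    simp only [pow_succ]

end Classes
end SwanClass

/-! ### The Swan subgroup is cyclic of order p -/

open SwanClass in
open NumberField in
theorem proposition3p6 (d p : ℕ) (hd : 0 < d) (hsq : Squarefree d) (hd1 : d ≠ 1) (hd3 : d ≠ 3)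
    (hp : p.Prime) (hp2 : 2 < p) (hpd : p ∣ d)
    (K : Type*) [Field K] [NumberField K] (α : K) (hα : α ^ 2 = -(d : K))
    (hK : IntermediateField.adjoin ℚ {α} = ⊤)
    (G : Type*) [CommGroup G] [Fintype G] [IsCyclic G] (hG : Fintype.card G = p) :
    (SwanClass.swanSubgroup K G : Set (SwanClass.Cl K G)) = SwanClass.swanClasses K G ∧
      Nonempty (SwanClass.swanSubgroup K G ≃+ ZMod p) := by
  obtain ⟨Q⟩ := nonempty_imaginaryQuadraticOrder hd hsq hα hK
  have hodd : Odd p := hp.odd_of_ne_two (by omega)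
  have hpu : ¬ IsUnit (p : 𝓞 K) := by
    intro h
    have h1 := (Q.dvd_of_dvd_add hp hp2 (m := 1) (n := 0) h.dvd).1
    have := Int.le_of_dvd one_pos h1
    omega
  have hGu : ¬ IsUnit (Fintype.card G : 𝓞 K) := by rwa [hG]
  have hne {r : 𝓞 K} (hr : IsCoprime r (Fintype.card G : 𝓞 K)) : r ≠ 0 := by
    rintro rfl
    exact hGu (isCoprime_zero_left.1 hr)
  obtain ⟨e, he⟩ := hpd
  have hroot : Q.root ^ 2 = -(Fintype.card G * e : 𝓞 K) := by
    rw [Q.root_sq, hG, he]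
    push_cast
    rfl
  -- (1 + √-d)(1 - √-d) = 1 + d = 1 + pe.
  have hc : IsCoprime (1 + Q.root) (Fintype.card G : 𝓞 K) :=
    ⟨1 - Q.root, -(e : 𝓞 K), by linear_combination -hroot⟩
  set c := swanClass G (1 + Q.root) hc with hcdef
  have hc0 : c ≠ 0 := fun h ↦
    not_exists_unit_of_aug_eq_one_add_root Q hd3 hp hp2 ⟨e, he⟩ hG
      (exists_unit_of_swanClass_eq_zero (hne hc) hc h)
  have hpc : p • c = 0 := by
    rw [hcdef, ← swanClass_pow (hne hc)]
    obtain ⟨t, ht⟩ := exists_one_add_pow_prime_eq hp Q.root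
    refine swanClass_eq_zero_of_eq_one_add
      (t := -(e : 𝓞 K) * Q.root ^ (p - 2) + Q.root * (1 + Q.root * t)) (hne hc.pow_left) _ ?_
    have h1 : Q.root ^ p = Q.root ^ (p - 2) * Q.root ^ 2 := by
      rw [← pow_add, Nat.sub_add_cancel hp2.le]
    rw [ht, h1, hroot, hG]
    ring
  have : Fact p.Prime := ⟨hp⟩
  have hord : addOrderOf c = p := addOrderOf_eq_prime hpc hc0
  have hgen (r : 𝓞 K) (hr : IsCoprime r (Fintype.card G : 𝓞 K)) :
      ∃ n : ℕ, swanClass G r hr = n • c := by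
    obtain ⟨a, b, y, ha0, hap, hb0, hbp, hab⟩ := Q.exists_eq_add_mul hodd r
    lift a to ℕ using ha0
    lift b to ℕ using hb0
    push_cast at hab
    have hcop : a.Coprime (Fintype.card G) := by
      rw [hG, Nat.coprime_comm, hp.coprime_iff_not_dvd]
      rintro ⟨f, rfl⟩
      -- If p divided a, then r ≡ b√-d and r² ≡ -db² ≡ 0 modulo p, contrary to coprimality.
      refine hGu ((hr.pow_left (m := 2)).isUnit_of_dvd' ?_ dvd_rfl)
      refine ⟨(f + y) * (2 * b * Q.root + p * (f + y)) - e * b ^ 2, ?_⟩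
      rw [hab]
      push_cast
      rw [hG] at hroot ⊢
      linear_combination (b : 𝓞 K) ^ 2 * hroot
    obtain ⟨l, -, hl⟩ := Nat.exists_mul_mod_eq_one_of_coprime hcop (hG ▸ hp.one_lt)
    have hl' : (a : 𝓞 K) * l = 1 + Fintype.card G * (a * l / Fintype.card G : ℕ) := by
      have := Nat.mod_add_div (a * l) (Fintype.card G)
      rw [hl] at this
      exact_mod_cast this.symm
    have ha : IsCoprime (a : 𝓞 K) (Fintype.card G : 𝓞 K) := hcop.cast
    -- Since al ≡ 1 and (√-d)² ≡ 0 modulo p, r ≡ a + b√-d ≡ a(1 + √-d)^(bl), and the class of the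
    -- integer a is zero.
    refine ⟨b * l, ?_⟩
    rw [hcdef, ← swanClass_pow (hne hc), ← zero_add (swanClass G (_ ^ (b * l)) _),
      ← swanClass_natCast_eq_zero (hne ha) (hG ▸ hp.one_lt) hcop ha, swanClass_add (hne ha)]
    obtain ⟨k, hk⟩ := Polynomial.powAddExpansion 1 Q.root (b * l)
    refine swanClass_eq_of_eq_add
      (t := y - (b : 𝓞 K) * Q.root * ((a * l / Fintype.card G : ℕ) : 𝓞 K) +
        (a : 𝓞 K) * k * (e : 𝓞 K))
      (hne hr) (hne (ha.mul_left hc.pow_left)) hGu _ _ ?_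
    rw [hab, hk]
    simp only [one_pow, mul_one]
    push_cast
    rw [hG] at hroot hl' ⊢
    linear_combination (-(b : 𝓞 K) * Q.root) * hl' - a * k * hroot
  have hsub : AddSubgroup.zmultiples c ≤ AddSubgroup.closure (swanClasses K G) := by
    rw [AddSubgroup.zmultiples_le]
    exact AddSubgroup.subset_closure ⟨_, hc, rfl⟩
  have hle : AddSubgroup.closure (swanClasses K G) ≤ AddSubgroup.zmultiples c := by
    rw [AddSubgroup.closure_le]
    rintro _ ⟨r, hr, rfl⟩
    obtain ⟨n, hn⟩ := hgen r hr
    rw [hn]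
    exact AddSubgroup.nsmul_mem_zmultiples _ _
  have heq : swanSubgroup K G = AddSubgroup.zmultiples c := le_antisymm hle hsub
  refine ⟨Set.Subset.antisymm ?_ AddSubgroup.subset_closure, ?_⟩
  · rw [heq]
    intro x hx
    -- Finite order makes every multiple of `c` a natural multiple, hence the class of a power of 1
    -- + √-d.
    have hfin : IsOfFinAddOrder c := isOfFinAddOrder_iff_nsmul_eq_zero.2 ⟨p, hp.pos, hpc⟩
    obtain ⟨n, rfl⟩ := hfin.mem_multiples_iff_mem_zmultiples.2 hx
    exact ⟨_, hc.pow_left, swanClass_pow (hne hc) hc n⟩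
  · rw [heq]
    have hcard : Nat.card (AddSubgroup.zmultiples c) = p := by
      rw [Nat.card_zmultiples, hord]
    exact ⟨(hcard ▸ zmodAddCyclicAddEquiv (inferInstance : IsAddCyclic (AddSubgroup.zmultiples c))
      ).symm⟩
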